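/- Work on $\mathfrak H=L^2(\mathbb R,dx)$ with the inner product linear in the second argument. For $z=(q+ip)/\sqrt2\in\mathbb C$ let $D(z)=e^{za^\dagger-\bar z a}$ be the displacement operator, $(D(z)\phi)(x)=e^{ip(x-q/2)}\phi(x-q)$. Let $\varpi:\mathbb C\to\mathbb C$ with $\varpi(0)=1$ define a bounded operator $M=\int_{\mathbb C}\varpi(z)D(z)\,\frac{d^2z}{\pi}$ in the weak sense: there is a dense subspace $V\subset\mathfrak H$, invariant under all $D(z)$, such that for all $\phi,\psi\in V$ the integral $\int\varpi(z)\langle\phi,D(z)\psi\rangle\frac{d^2z}{\pi}$ converges absolutely and equals $\langle\phi,M\psi\rangle$. For a function $f$ on $\mathbb C$, its quantization is the bounded operator $A_f=\int_{\mathbb C}f(z)\,D(z)MD(z)^\dagger\,\frac{d^2z}{\pi}$, when it exists, in the sense that $\langle\phi,A_f\psi\rangle=\int f(z)\langle\phi,D(z)MD(z)^\dagger\psi\rangle\frac{d^2z}{\pi}$, with absolute convergence, for all $\phi,\psi\in\mathfrak H$. Write $L^p=L^p(\mathbb C,\frac{d^2z}{\pi})$. 1. The following are equivalent: (a) every $f\in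 L^2$ has a quantization $A_f$, and $\mathrm{tr}(A_f^\dagger A_f)=\int_{\mathbb C}|f(z)|^2\,\frac{d^2z}{\pi}$; (b) the same holds for every $f\in L^1\cap L^2$; (c) $|\varpi(z)|=1$ for almost every $z\in\mathbb C$. If $\varpi$ is continuous, (c) may be replaced by: $|\varpi(z)|=1$ for all $z\in\mathbb C$. 2. If these conditions hold, then $f\mapsto A_f$ is a bijection of $L^2$ (modulo equality almost everywhere) onto the Hilbert–Schmidt operators on $\mathfrak H$, and its inverse is $A\mapsto W_A$, $W_A(z)=\mathrm{tr}\big(D(z)M^\dagger D(z)^\dagger A\big)$. Here, if $A$ is trace class, the trace exists for every $z$; for a general Hilbert–Schmidt operator $A$ the formula means that, for every orthonormal basis $(b_n)_{n\in\mathbb N}$ of $\mathfrak H$, the series $\sum_n\langle b_n,D(z)M^\dagger D(z)^\dagger A\,b_n\rangle$ converges unconditionally in $L^2$ to $W_A$. 3. If moreover $\varpi$ is regular, that is $\varpi(-z)=\varpi(z)$ and $\overline{\varpi(z)}=\varpi(z)$ for all $z$, then $M=M^\dagger$, so that the inverse is $A\mapsto\mathrm{tr}\big(D(z)MD(z)^\dagger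 A\big)$, with the trace understood in the same way. -/

import Mathlib

open MeasureTheory Filter Topology
open scoped ENNReal InnerProductSpace

noncomputable section

namespace WeylHeisenberg

/-- The Hilbert space `L²(ℝ, dx)` carrying the Schrödinger representation. -/
abbrev H : Type := Lp ℂ 2 (volume : Measure ℝ)

/-- The invariant measure `d²z / π` on the phase space `ℂ`. -/
def phaseMeasure : Measure ℂ := ENNReal.ofReal Real.pi⁻¹ • volume

/-- Position coordinate: `z = (q + i p) / √2`. -/
def pos (z : ℂ) : ℝ := √2 * z.re

/-- Momentum coordinate: `z = (q + i p) / √2`. -/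
def mom (z : ℂ) : ℝ := √2 * z.im

/-- The function `x ↦ e^{i p (x - q/2)} φ (x - q)`, for `z = (q + i p) / √2`. -/
def displaceFun (z : ℂ) (φ : ℝ → ℂ) (x : ℝ) : ℂ :=
  Complex.exp (((mom z * (x - pos z / 2) : ℝ) : ℂ) * Complex.I) * φ (x - pos z)

theorem phase_continuous (z : ℂ) :
    Continuous fun x : ℝ => Complex.exp (((mom z * (x - pos z / 2) : ℝ) : ℂ) * Complex.I) := by
  fun_prop

theorem translate_mp (z : ℂ) :
    MeasurePreserving (fun x : ℝ => x - pos z) volume volume :=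
  measurePreserving_sub_right volume (pos z)

theorem displaceFun_aesm (z : ℂ) {φ : ℝ → ℂ} (hφ : AEStronglyMeasurable φ volume) :
    AEStronglyMeasurable (displaceFun z φ) volume :=
  (phase_continuous z).aestronglyMeasurable.mul
    (hφ.comp_measurePreserving (translate_mp z))

theorem displaceFun_eLpNorm (z : ℂ) {φ : ℝ → ℂ} (hφ : AEStronglyMeasurable φ volume) :
    eLpNorm (displaceFun z φ) 2 volume = eLpNorm φ 2 volume := by
  rw [← eLpNorm_comp_measurePreserving hφ (translate_mp z)]
  refine eLpNorm_congr_norm_ae (Eventually.of_forall fun x => ?_)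
  simp only [displaceFun, norm_mul, Complex.norm_exp_ofReal_mul_I, one_mul, Function.comp]

theorem displaceFun_memLp (z : ℂ) {φ : ℝ → ℂ} (hφ : MemLp φ 2 volume) :
    MemLp (displaceFun z φ) 2 volume :=
  ⟨displaceFun_aesm z hφ.1, by rw [displaceFun_eLpNorm z hφ.1]; exact hφ.2⟩

theorem displaceFun_congr (z : ℂ) {φ ψ : ℝ → ℂ} (h : φ =ᵐ[volume] ψ) :
    displaceFun z φ =ᵐ[volume] displaceFun z ψ := by
  have h' := (translate_mp z).quasiMeasurePreserving.ae_eq_comp h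
  filter_upwards [h'] with x hx
  simp only [Function.comp] at hx
  simp only [displaceFun, hx]

/-- The displacement operator `D(z) = exp (z a† - z̄ a)` in the Schrödinger representation,
as an isometry: `(D(z) φ)(x) = e^{i p (x - q/2)} φ(x - q)` with `z = (q + i p) / √2`. -/
def displacementIsometry (z : ℂ) : H →ₗᵢ[ℂ] H where
  toFun φ := (displaceFun_memLp z (Lp.memLp φ)).toLp _
  map_add' φ ψ := by
    rw [← MemLp.toLp_add]
    refine MemLp.toLp_congr _ _ ?_
    refine (displaceFun_congr z (Lp.coeFn_add φ ψ)).trans (Eventually.of_forall fun x => ?_)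
    simp only [displaceFun, Pi.add_apply, mul_add]
  map_smul' c φ := by
    rw [RingHom.id_apply, ← MemLp.toLp_const_smul]
    refine MemLp.toLp_congr _ _ ?_
    refine (displaceFun_congr z (Lp.coeFn_smul c φ)).trans (Eventually.of_forall fun x => ?_)
    simp only [displaceFun, Pi.smul_apply, smul_eq_mul]
    ring
  norm_map' φ := by
    change ‖(displaceFun_memLp z (Lp.memLp φ)).toLp _‖ = ‖φ‖
    rw [Lp.norm_toLp, displaceFun_eLpNorm z (Lp.memLp φ).1, Lp.norm_def]

/-- The displacement operator `D(z)` as a bounded operator. -/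
def D (z : ℂ) : H →L[ℂ] H := (displacementIsometry z).toContinuousLinearMap

theorem D_coeFn (z : ℂ) (φ : H) :
    (D z φ : ℝ → ℂ) =ᵐ[volume] displaceFun z φ :=
  MemLp.coeFn_toLp (displaceFun_memLp z (Lp.memLp φ))

/-- The displaced operator `M(z) = D(z) M D(z)†`. -/
def displaced (M : H →L[ℂ] H) (z : ℂ) : H →L[ℂ] H :=
  D z ∘L M ∘L ContinuousLinearMap.adjoint (D z)

/-- The weight function `ϖ` defines the bounded operator `M = ∫ ϖ(z) D(z) d²z/π`, the integral
being understood weakly, as a sesquilinear form on a dense subspace which is invariant under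
the displacement operators. -/
def IsWeightIntegral (ϖ : ℂ → ℂ) (M : H →L[ℂ] H) : Prop :=
  ∃ V : Submodule ℂ H, Dense (V : Set H) ∧ (∀ z, ∀ φ ∈ V, D z φ ∈ V) ∧
    ∀ φ ∈ V, ∀ ψ ∈ V,
      Integrable (fun z => ϖ z * ⟪φ, D z ψ⟫_ℂ) phaseMeasure ∧
      ⟪φ, M ψ⟫_ℂ = ∫ z, ϖ z * ⟪φ, D z ψ⟫_ℂ ∂phaseMeasure

/-- `A` is the quantization `A_f = ∫ f(z) M(z) d²z/π` of `f`, as an absolutely convergent weak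
integral. -/
def IsQuantization (M : H →L[ℂ] H) (f : ℂ → ℂ) (A : H →L[ℂ] H) : Prop :=
  ∀ φ ψ : H,
    Integrable (fun z => f z * ⟪φ, displaced M z ψ⟫_ℂ) phaseMeasure ∧
    ⟪φ, A ψ⟫_ℂ = ∫ z, f z * ⟪φ, displaced M z ψ⟫_ℂ ∂phaseMeasure

/-- The operator `A_f` is determined by `f`. -/
theorem IsQuantization.unique {M : H →L[ℂ] H} {f : ℂ → ℂ} {A B : H →L[ℂ] H}
    (hA : IsQuantization M f A) (hB : IsQuantization M f B) : A = B := by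
  ext1 ψ
  refine ext_inner_left ℂ fun φ => ?_
  rw [(hA φ ψ).2, (hB φ ψ).2]

/-- The operator `T` has trace `t`: `∑ₙ ⟨bₙ, T bₙ⟩` converges (unconditionally) to `t` for every
orthonormal basis `b`. -/
def HasTrace (T : H →L[ℂ] H) (t : ℂ) : Prop :=
  ∀ b : HilbertBasis ℕ ℂ H, HasSum (fun n => ⟪b n, T (b n)⟫_ℂ) t

/-- Hilbert–Schmidt operators: `tr (A† A) < ∞`. -/
def IsHilbertSchmidt (A : H →L[ℂ] H) : Prop :=
  ∃ t : ℂ, HasTrace (ContinuousLinearMap.adjoint A ∘L A) t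

/-- Trace class operators: products of two Hilbert–Schmidt operators. -/
def IsTraceClass (A : H →L[ℂ] H) : Prop :=
  ∃ B C : H →L[ℂ] H, IsHilbertSchmidt B ∧ IsHilbertSchmidt C ∧ A = B ∘L C

/-- Every function `f` of the class `S` has a quantization `A_f`, and
`tr (A_f† A_f) = ∫ |f(z)|² d²z/π`. -/
def IsometricOn (M : H →L[ℂ] H) (S : Set (ℂ → ℂ)) : Prop :=
  ∀ f ∈ S, ∃ A : H →L[ℂ] H, IsQuantization M f A ∧
    HasTrace (ContinuousLinearMap.adjoint A ∘L A) ((∫ z, ‖f z‖ ^ 2 ∂phaseMeasure : ℝ) : ℂ)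

/-- `L²(ℂ, d²z/π)`. -/
def squareIntegrable : Set (ℂ → ℂ) := {f | MemLp f 2 phaseMeasure}

/-- `L¹ ∩ L²` for the measure `d²z/π`; on this class the quantization is defined for every
bounded `M`. -/
def integrableSquareIntegrable : Set (ℂ → ℂ) :=
  {f | MemLp f 1 phaseMeasure ∧ MemLp f 2 phaseMeasure}

/-- The quantization `f ↦ A_f` maps `L²(ℂ, d²z/π)` (modulo null functions) bijectively onto
the Hilbert–Schmidt operators. -/
def IsInvertible (M : H →L[ℂ] H) : Prop :=
  (∀ f ∈ squareIntegrable, ∃ A, IsQuantization M f A ∧ IsHilbertSchmidt A) ∧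
  (∀ A, IsHilbertSchmidt A → ∃ f ∈ squareIntegrable, IsQuantization M f A) ∧
  (∀ f ∈ squareIntegrable, ∀ g ∈ squareIntegrable, ∀ A,
    IsQuantization M f A → IsQuantization M g A → f =ᵐ[phaseMeasure] g)

/-- The inverse of `f ↦ A_f` is `A ↦ W`, `W(z) = tr (D(z) N D(z)† A)`.  For a trace class
operator `A` the trace exists at every `z`; for a general Hilbert–Schmidt operator the series
`∑ₙ ⟨bₙ, D(z) N D(z)† A bₙ⟩` converges to `W` in `L²(ℂ, d²z/π)`, for each orthonormal basis. -/
def InverseIsTrace (M N : H →L[ℂ] H) : Prop :=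
  ∀ A : H →L[ℂ] H, IsHilbertSchmidt A →
    ∃ W ∈ squareIntegrable,
      IsQuantization M W A ∧
      (∀ f ∈ squareIntegrable, IsQuantization M f A → f =ᵐ[phaseMeasure] W) ∧
      (∀ b : HilbertBasis ℕ ℂ H,
        Tendsto (fun s : Finset ℕ =>
          eLpNorm (fun z => (∑ n ∈ s, ⟪b n, (displaced N z ∘L A) (b n)⟫_ℂ) - W z) 2 phaseMeasure)
          atTop (𝓝 0)) ∧
      (IsTraceClass A → ∀ z, HasTrace (displaced N z ∘L A) (W z))

/-- Regular weight functions: even and real valued. -/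
def IsRegularWeight (ϖ : ℂ → ℂ) : Prop :=
  (∀ z, ϖ (-z) = ϖ z) ∧ ∀ z, starRingEnd ℂ (ϖ z) = ϖ z

end WeylHeisenberg

end

open WeylHeisenberg

/-!
The displacement operators form a Moyal frame: their matrix coefficients obey orthogonality
relations and are total in `L²(ℂ)`, so that `f ↦ ∫ f(z) D(z)` is unitary from `L²(ℂ)` onto the
Hilbert–Schmidt operators. Because `D(z) D(w) D(z)†` is `D(w)` up to the symplectic phase, the
matrix coefficients of `D(z) M D(z)†` are the symplectic Fourier transforms of `ϖ` times those of
`D`. If `|ϖ| = 1` almost everywhere they are the image of a Moyal frame under a unitary, hence again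
a Moyal frame. Conversely, the isometry property says that multiplication by `ϖ` preserves the norm
of the symplectic Fourier transform of every function in `L¹ ∩ L²`; these are dense in `L²`, so
`|ϖ| = 1` almost everywhere.
-/

noncomputable section

namespace WeylHeisenberg

section HilbertBasis

variable {ι κ 𝕜 E F : Type*} [RCLike 𝕜] [NormedAddCommGroup E] [InnerProductSpace 𝕜 E]
  [NormedAddCommGroup F] [InnerProductSpace 𝕜 F]

theorem continuousLinearMap_ext_hilbertBasis (b : HilbertBasis ι 𝕜 E) (c : HilbertBasis κ 𝕜 F)
    {A B : E →L[𝕜] F} (h : ∀ i j, ⟪c j, A (b i)⟫_𝕜 = ⟪c j, B (b i)⟫_𝕜) : A = B := by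
  refine ContinuousLinearMap.ext_on (s := Set.range b)
    (Submodule.dense_iff_topologicalClosure_eq_top.2 b.dense_span) ?_
  rintro _ ⟨i, rfl⟩
  refine c.repr.injective ?_
  ext j
  rw [c.repr_apply_apply, c.repr_apply_apply, h]

theorem hasSum_norm_inner_sq (b : HilbertBasis ι 𝕜 E) (x : E) :
    HasSum (fun i => ‖⟪b i, x⟫_𝕜‖ ^ 2) (‖x‖ ^ 2) := by
  have h := RCLike.hasSum_re 𝕜 (b.hasSum_inner_mul_inner x x)
  rw [inner_self_eq_norm_sq] at h
  refine h.congr_fun fun i => ?_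
  rw [← inner_conj_symm x, RCLike.conj_mul]
  norm_cast

theorem hasSum_norm_inner_apply_sq (b : HilbertBasis ι 𝕜 E) (c : HilbertBasis κ 𝕜 F)
    {A : E →L[𝕜] F} {s : ℝ} (hA : HasSum (fun i => ‖A (b i)‖ ^ 2) s) :
    HasSum (fun p : ι × κ => ‖⟪c p.2, A (b p.1)⟫_𝕜‖ ^ 2) s := by
  have hrow (i : ι) := hasSum_norm_inner_sq c (A (b i))
  have hprod : Summable fun p : ι × κ => ‖⟪c p.2, A (b p.1)⟫_𝕜‖ ^ 2 :=
    (summable_prod_of_nonneg fun _ => sq_nonneg _).2 ⟨fun i => (hrow i).summable,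
      hA.summable.congr fun i => (hrow i).tsum_eq.symm⟩
  rw [hA.unique (hprod.hasSum.prod_fiberwise hrow)]
  exact hprod.hasSum

variable [CompleteSpace E] [CompleteSpace F]

theorem hasSum_norm_adjoint_apply_sq (b : HilbertBasis ι 𝕜 E) (c : HilbertBasis κ 𝕜 F)
    {A : E →L[𝕜] F} {s : ℝ} (hA : HasSum (fun i => ‖A (b i)‖ ^ 2) s) :
    HasSum (fun j => ‖ContinuousLinearMap.adjoint A (c j)‖ ^ 2) s := by
  have h := hasSum_norm_inner_apply_sq b c hA
  rw [← (Equiv.prodComm κ ι).hasSum_iff] at h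
  refine h.prod_fiberwise fun j => ?_
  simpa only [Function.comp_apply, Equiv.prodComm_apply, Prod.fst_swap, Prod.snd_swap,
    ContinuousLinearMap.adjoint_inner_right, norm_inner_symm (A _)] using
    hasSum_norm_inner_sq b (ContinuousLinearMap.adjoint A (c j))

theorem hasSum_norm_apply_sq_of_hilbertBasis (b : HilbertBasis ι 𝕜 E) (b' : HilbertBasis κ 𝕜 E)
    {A : E →L[𝕜] F} {s : ℝ} (hA : HasSum (fun i => ‖A (b i)‖ ^ 2) s) :
    HasSum (fun j => ‖A (b' j)‖ ^ 2) s := by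
  obtain ⟨_, c, -⟩ := exists_hilbertBasis 𝕜 F
  simpa only [ContinuousLinearMap.adjoint_adjoint] using
    hasSum_norm_adjoint_apply_sq c b' (hasSum_norm_adjoint_apply_sq b c hA)

end HilbertBasis

section Separable

variable {𝕜 E : Type*} [RCLike 𝕜] [NormedAddCommGroup E] [InnerProductSpace 𝕜 E]
  [TopologicalSpace.SeparableSpace E]

theorem countable_of_orthonormal {ι : Type*} {v : ι → E} (hv : Orthonormal 𝕜 v) :
    Countable ι := by
  have hdist {i j : ι} (hij : i ≠ j) : 1 ≤ dist (v i) (v j) := by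
    have h := @norm_sub_sq 𝕜 _ _ _ _ (v i) (v j)
    rw [hv.2 hij, hv.1 i, hv.1 j, map_zero] at h
    rw [dist_eq_norm]
    nlinarith [norm_nonneg (v i - v j)]
  rw [← Set.countable_univ_iff]
  refine Set.PairwiseDisjoint.countable_of_isOpen (s := fun i => Metric.ball (v i) (1 / 2))
    (fun i _ j _ hij => Metric.ball_disjoint_ball ?_) (fun _ _ => Metric.isOpen_ball)
    fun i _ => ⟨v i, Metric.mem_ball_self (by norm_num)⟩
  linarith [hdist hij]

theorem nonempty_hilbertBasis_nat [CompleteSpace E] (hE : ¬ FiniteDimensional 𝕜 E) :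
    Nonempty (HilbertBasis ℕ 𝕜 E) := by
  obtain ⟨w, b, -⟩ := exists_hilbertBasis 𝕜 E
  have : Countable w := countable_of_orthonormal b.orthonormal
  have : Infinite w := by
    by_contra hw
    rw [not_infinite_iff_finite] at hw
    have := Fintype.ofFinite w
    exact hE b.toOrthonormalBasis.toBasis.finiteDimensional_of_finite
  obtain ⟨e⟩ := nonempty_equiv_of_countable (α := w) (β := ℕ)
  refine ⟨HilbertBasis.mk (v := b ∘ e.symm) (b.orthonormal.comp _ e.symm.injective) ?_⟩
  rw [e.symm.surjective.range_comp, b.dense_span]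

end Separable

section LpSpace

variable {α F : Type*} [MeasurableSpace α] {μ : Measure α} [NormedAddCommGroup F]

theorem eLpNorm_two_sq (f : α → F) : eLpNorm f 2 μ ^ 2 = ∫⁻ x, ‖f x‖ₑ ^ 2 ∂μ := by
  simpa using eLpNorm_nnreal_pow_eq_lintegral (p := 2) (f := f) (μ := μ) two_ne_zero

theorem eLpNorm_two_eq_iff {f : α → F} {a : ℝ≥0∞} :
    eLpNorm f 2 μ = a ↔ ∫⁻ x, ‖f x‖ₑ ^ 2 ∂μ = a ^ 2 := by
  rw [← eLpNorm_two_sq, (ENNReal.pow_right_strictMono two_ne_zero).injective.eq_iff]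

theorem ae_eq_of_tendsto_eLpNorm_of_tendsto {p : ℝ≥0∞} (hp : p ≠ 0) {u : ℕ → α → F}
    {f g : α → F} (hu : ∀ n, AEStronglyMeasurable (u n) μ) (hf : AEStronglyMeasurable f μ)
    (huf : Tendsto (fun n => eLpNorm (u n - f) p μ) atTop (𝓝 0))
    (hug : ∀ᵐ x ∂μ, Tendsto (fun n => u n x) atTop (𝓝 (g x))) : f =ᵐ[μ] g := by
  obtain ⟨ns, hns, hlim⟩ := (tendstoInMeasure_of_tendsto_eLpNorm hp hu hf huf).exists_seq_tendsto_ae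
  filter_upwards [hlim, hug] with x hx hx'
  exact tendsto_nhds_unique hx (hx'.comp hns.tendsto_atTop)

theorem exists_seq_tendsto_eLpNorm_of_dense {p : ℝ≥0∞} [Fact (1 ≤ p)] {S : Set (Lp F p μ)}
    (hS : Dense S) (f : Lp F p μ) : ∃ u : ℕ → Lp F p μ, (∀ n, u n ∈ S) ∧
      Tendsto u atTop (𝓝 f) ∧ ∀ᵐ x ∂μ, Tendsto (fun n => u n x) atTop (𝓝 (f x)) := by
  obtain ⟨u, huS, hu⟩ := mem_closure_iff_seq_limit.1 (hS f)
  have hp : p ≠ 0 := (zero_lt_one.trans_le (Fact.out : 1 ≤ p)).ne'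
  obtain ⟨ns, hns, hlim⟩ := (tendstoInMeasure_of_tendsto_eLpNorm hp
    (fun n => Lp.aestronglyMeasurable (u n)) (Lp.aestronglyMeasurable f)
    ((Lp.tendsto_Lp_iff_tendsto_eLpNorm' u f).1 hu)).exists_seq_tendsto_ae
  exact ⟨u ∘ ns, fun n => huS _, hu.comp hns.tendsto_atTop, hlim⟩

theorem dense_setOf_integrable {p : ℝ≥0∞} [Fact (1 ≤ p)] (hp : p ≠ ∞) :
    Dense {f : Lp F p μ | Integrable f μ} := by
  have hp0 : p ≠ 0 := (zero_lt_one.trans_le (Fact.out : 1 ≤ p)).ne'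
  refine (Lp.simpleFunc.denseRange hp).mono ?_
  rintro _ ⟨g, rfl⟩
  refine Integrable.congr ?_ (Lp.simpleFunc.toSimpleFunc_eq_toFun g)
  exact (SimpleFunc.memLp_iff_integrable hp0 hp).1 (Lp.simpleFunc.memLp g)

end LpSpace

section Multiplication

variable {α : Type*} [MeasurableSpace α] {μ : Measure α} {w : α → ℂ}

theorem eLpNorm_mul_le_of_dense (hw : AEStronglyMeasurable w μ) {S : Set (Lp ℂ 2 μ)}
    (hS : Dense S) (h : ∀ k ∈ S, eLpNorm (fun x => w x * k x) 2 μ ≤ eLpNorm k 2 μ)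
    (k : Lp ℂ 2 μ) : eLpNorm (fun x => w x * k x) 2 μ ≤ eLpNorm k 2 μ := by
  obtain ⟨u, huS, hu, hlim⟩ := exists_seq_tendsto_eLpNorm_of_dense hS k
  have hnorm : Tendsto (fun n => eLpNorm (u n) 2 μ) atTop (𝓝 (eLpNorm k 2 μ)) := by
    simpa only [Lp.enorm_def] using hu.enorm
  calc eLpNorm (fun x => w x * k x) 2 μ
      ≤ liminf (fun n => eLpNorm (fun x => w x * u n x) 2 μ) atTop :=
        Lp.eLpNorm_lim_le_liminf_eLpNorm (fun n => hw.mul (Lp.aestronglyMeasurable _)) _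
          (hlim.mono fun x hx => hx.const_mul (w x))
    _ ≤ liminf (fun n => eLpNorm (u n) 2 μ) atTop :=
        liminf_le_liminf (Eventually.of_forall fun n => h _ (huS n))
    _ = eLpNorm k 2 μ := hnorm.liminf_eq

theorem eLpNorm_mul_eq_of_dense (hw : AEStronglyMeasurable w μ) {S : Set (Lp ℂ 2 μ)}
    (hS : Dense S) (h : ∀ k ∈ S, eLpNorm (fun x => w x * k x) 2 μ = eLpNorm k 2 μ)
    (k : Lp ℂ 2 μ) : eLpNorm (fun x => w x * k x) 2 μ = eLpNorm k 2 μ := by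
  have hle := eLpNorm_mul_le_of_dense hw hS fun k hk => (h k hk).le
  refine le_antisymm (hle k) ?_
  obtain ⟨u, huS, hu, -⟩ := exists_seq_tendsto_eLpNorm_of_dense hS k
  have hnorm : Tendsto (fun n => ‖u n‖ₑ) atTop (𝓝 ‖k‖ₑ) := hu.enorm
  have hdiff : Tendsto (fun n => ‖u n - k‖ₑ) atTop (𝓝 0) := by
    simpa using (hu.sub_const k).enorm
  have hbound (n : ℕ) : ‖u n‖ₑ ≤ eLpNorm (fun x => w x * k x) 2 μ + ‖u n - k‖ₑ := calc
    ‖u n‖ₑ = eLpNorm (fun x => w x * u n x) 2 μ := by rw [h _ (huS n), Lp.enorm_def]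
    _ = eLpNorm ((fun x => w x * k x) + fun x => w x * (u n - k : Lp ℂ 2 μ) x) 2 μ := by
      refine eLpNorm_congr_ae ?_
      filter_upwards [Lp.coeFn_sub (u n) k] with x hx
      simp only [hx, Pi.add_apply, Pi.sub_apply]
      ring
    _ ≤ eLpNorm (fun x => w x * k x) 2 μ + eLpNorm (fun x => w x * (u n - k : Lp ℂ 2 μ) x) 2 μ :=
      eLpNorm_add_le (hw.mul (Lp.aestronglyMeasurable _)) (hw.mul (Lp.aestronglyMeasurable _))
        one_le_two
    _ ≤ eLpNorm (fun x => w x * k x) 2 μ + ‖u n - k‖ₑ := by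
      rw [Lp.enorm_def]
      gcongr
      exact hle _
  simpa [Lp.enorm_def] using le_of_tendsto_of_tendsto' hnorm (hdiff.const_add _) hbound

theorem norm_eq_one_ae_of_eLpNorm_mul_eq [SigmaFinite μ] (hw : AEStronglyMeasurable w μ)
    (h : ∀ k : Lp ℂ 2 μ, eLpNorm (fun x => w x * k x) 2 μ = eLpNorm k 2 μ) :
    ∀ᵐ x ∂μ, ‖w x‖ = 1 := by
  have hsq : (fun x => ‖w x‖ₑ ^ 2) =ᵐ[μ] fun _ => 1 := by
    refine ae_eq_of_forall_setLIntegral_eq_of_sigmaFinite₀ (hw.enorm.pow_const 2)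
      aemeasurable_const fun s hs hμs => ?_
    have hk := h (indicatorConstLp 2 hs hμs.ne 1)
    rw [eLpNorm_two_eq_iff, eLpNorm_two_sq] at hk
    rw [← lintegral_indicator hs, ← lintegral_indicator hs]
    convert hk using 1 <;> refine lintegral_congr_ae ?_ <;>
      filter_upwards [indicatorConstLp_coeFn (p := 2) (hs := hs) (hμs := hμs.ne) (c := (1 : ℂ))]
        with x hx <;>
      by_cases hxs : x ∈ s <;> simp [hx, hxs]
  filter_upwards [hsq] with x hx
  refine (pow_eq_one_iff_of_nonneg (norm_nonneg _) two_ne_zero).1 ?_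
  simpa only [ENNReal.toReal_pow, toReal_enorm, ENNReal.toReal_one] using
    congrArg ENNReal.toReal hx

end Multiplication

section WeightedComposition

variable {α β : Type*} [MeasurableSpace α] [MeasurableSpace β] {μ : Measure α} {ν : Measure β}
  {e : α ≃ᵐ β} {w : α → ℂ}

/-- A weight `w` for which the weighted composition `f ↦ w • (f ∘ e)` is unitary from `L²(ν)` onto
`L²(μ)`. -/
structure IsUnitaryWeight (e : α ≃ᵐ β) (w : α → ℂ) (μ : Measure α) (ν : Measure β) : Prop where
  aestronglyMeasurable : AEStronglyMeasurable w μ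
  ne_zero : ∀ᵐ x ∂μ, w x ≠ 0
  map_withDensity : (μ.withDensity fun x => ‖w x‖ₑ ^ 2).map e = ν

namespace IsUnitaryWeight

theorem quasiMeasurePreserving (hw : IsUnitaryWeight e w μ ν) :
    Measure.QuasiMeasurePreserving e μ ν := by
  have hμ : μ ≪ μ.withDensity fun x => ‖w x‖ₑ ^ 2 :=
    withDensity_absolutelyContinuous' (hw.aestronglyMeasurable.enorm.pow_const 2)
      (hw.ne_zero.mono fun x hx => by simpa using hx)
  exact ⟨e.measurable, hw.map_withDensity ▸ hμ.map e.measurable⟩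

theorem quasiMeasurePreserving_symm (hw : IsUnitaryWeight e w μ ν) :
    Measure.QuasiMeasurePreserving e.symm ν μ := by
  refine ⟨e.symm.measurable, ?_⟩
  rw [← hw.map_withDensity, MeasurableEquiv.map_symm_map]
  exact withDensity_absolutelyContinuous _ _

theorem eLpNorm_mul_comp (hw : IsUnitaryWeight e w μ ν) {f : β → ℂ}
    (hf : AEStronglyMeasurable f ν) : eLpNorm (fun x => w x * f (e x)) 2 μ = eLpNorm f 2 ν := by
  have hfe : AEMeasurable (fun x => ‖f (e x)‖ₑ ^ 2) μ :=
    (hf.comp_quasiMeasurePreserving hw.quasiMeasurePreserving).enorm.pow_const 2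
  rw [eLpNorm_two_eq_iff, eLpNorm_two_sq, ← hw.map_withDensity, lintegral_map_equiv,
    lintegral_withDensity_eq_lintegral_mul₀ (hw.aestronglyMeasurable.enorm.pow_const 2) hfe]
  simp only [enorm_mul, mul_pow, Pi.mul_apply]

theorem memLp_mul_comp (hw : IsUnitaryWeight e w μ ν) {f : β → ℂ} (hf : MemLp f 2 ν) :
    MemLp (fun x => w x * f (e x)) 2 μ :=
  ⟨hw.aestronglyMeasurable.mul (hf.1.comp_quasiMeasurePreserving hw.quasiMeasurePreserving),
    (hw.eLpNorm_mul_comp hf.1).trans_lt hf.2⟩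

/-- The isometry `f ↦ w • (f ∘ e)` from `L²(ν)` to `L²(μ)`. -/
def isometry (hw : IsUnitaryWeight e w μ ν) : Lp ℂ 2 ν →ₗᵢ[ℂ] Lp ℂ 2 μ where
  toFun f := (hw.memLp_mul_comp (Lp.memLp f)).toLp _
  map_add' f g := by
    rw [← MemLp.toLp_add]
    refine MemLp.toLp_congr _ _ ?_
    filter_upwards [hw.quasiMeasurePreserving.ae_eq_comp (Lp.coeFn_add f g)] with x hx
    simp only [Function.comp_apply, Pi.add_apply] at hx ⊢
    rw [hx, mul_add]
  map_smul' c f := by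
    rw [RingHom.id_apply, ← MemLp.toLp_const_smul]
    refine MemLp.toLp_congr _ _ ?_
    filter_upwards [hw.quasiMeasurePreserving.ae_eq_comp (Lp.coeFn_smul c f)] with x hx
    simp only [Function.comp_apply, Pi.smul_apply, smul_eq_mul] at hx ⊢
    rw [hx, mul_left_comm]
  norm_map' f := by
    change ‖(hw.memLp_mul_comp (Lp.memLp f)).toLp _‖ = ‖f‖
    rw [Lp.norm_toLp, hw.eLpNorm_mul_comp (Lp.aestronglyMeasurable f), Lp.norm_def]

theorem coeFn_isometry (hw : IsUnitaryWeight e w μ ν) (f : Lp ℂ 2 ν) :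
    hw.isometry f =ᵐ[μ] fun x => w x * f (e x) :=
  MemLp.coeFn_toLp (hw.memLp_mul_comp (Lp.memLp f))

theorem isometry_surjective (hw : IsUnitaryWeight e w μ ν) : Function.Surjective hw.isometry := by
  intro g
  set f : β → ℂ := fun y => (w (e.symm y))⁻¹ * g (e.symm y) with hf_def
  have hf : AEStronglyMeasurable f ν :=
    (hw.aestronglyMeasurable.inv₀.mul (Lp.aestronglyMeasurable g)).comp_quasiMeasurePreserving
      hw.quasiMeasurePreserving_symm
  have hwf : (fun x => w x * f (e x)) =ᵐ[μ] g := by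
    filter_upwards [hw.ne_zero] with x hx
    simp only [hf_def, MeasurableEquiv.symm_apply_apply, mul_inv_cancel_left₀ hx]
  have hf2 : MemLp f 2 ν :=
    ⟨hf, by rw [← hw.eLpNorm_mul_comp hf, eLpNorm_congr_ae hwf]; exact Lp.eLpNorm_lt_top g⟩
  refine ⟨hf2.toLp f, Lp.ext ((hw.coeFn_isometry _).trans (EventuallyEq.trans ?_ hwf))⟩
  filter_upwards [hw.quasiMeasurePreserving.ae_eq_comp hf2.coeFn_toLp] with x hx
  simp only [Function.comp_apply] at hx
  rw [hx]

/-- The unitary operator `f ↦ w • (f ∘ e)` from `L²(ν)` onto `L²(μ)`. -/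
def unitary (hw : IsUnitaryWeight e w μ ν) : Lp ℂ 2 ν ≃ₗᵢ[ℂ] Lp ℂ 2 μ :=
  LinearIsometryEquiv.ofSurjective hw.isometry hw.isometry_surjective

theorem coeFn_unitary (hw : IsUnitaryWeight e w μ ν) (f : Lp ℂ 2 ν) :
    hw.unitary f =ᵐ[μ] fun x => w x * f (e x) :=
  hw.coeFn_isometry f

theorem of_norm_eq_one (hw : AEStronglyMeasurable w μ) (hw1 : ∀ᵐ x ∂μ, ‖w x‖ = 1) :
    IsUnitaryWeight (MeasurableEquiv.refl α) w μ μ where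
  aestronglyMeasurable := hw
  ne_zero := hw1.mono fun x hx h0 => by simp [h0] at hx
  map_withDensity := by
    have h : (fun x => ‖w x‖ₑ ^ 2) =ᵐ[μ] 1 := hw1.mono fun x hx => by
      simp [← ofReal_norm, hx]
    rw [withDensity_congr_ae h, withDensity_one]
    exact Measure.map_id

theorem const {c : ℂ} (hc : c ≠ 0) (hν : ‖c‖ₑ ^ 2 • μ.map e = ν) :
    IsUnitaryWeight e (fun _ => c) μ ν where
  aestronglyMeasurable := aestronglyMeasurable_const
  ne_zero := Eventually.of_forall fun _ => hc
  map_withDensity := by rw [withDensity_const, Measure.map_smul, hν]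

end IsUnitaryWeight

end WeightedComposition

section Fourier

open FourierTransform SchwartzMap

variable {E F : Type*} [NormedAddCommGroup E] [InnerProductSpace ℝ E]
  [NormedAddCommGroup F]

/-- A smooth compactly supported real function as a complex Schwartz function. -/
def testFunction {g : E → ℝ} (hg : ContDiff ℝ ((⊤ : ℕ∞) : WithTop ℕ∞) g)
    (hgc : HasCompactSupport g) : 𝓢(E, ℂ) :=
  (hgc.comp_left (g := Complex.ofRealCLM) (map_zero _)).toSchwartzMap
    (Complex.ofRealCLM.contDiff.comp hg)

theorem testFunction_smul [NormedSpace ℂ F] {g : E → ℝ}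
    (hg : ContDiff ℝ ((⊤ : ℕ∞) : WithTop ℕ∞) g) (hgc : HasCompactSupport g) (x : E) (v : F) :
    testFunction hg hgc x • v = g x • v := by
  simp [testFunction]

variable [FiniteDimensional ℝ E] [MeasurableSpace E] [BorelSpace E]

theorem integral_smul_fourier_eq [NormedSpace ℂ F] [CompleteSpace F] {g : E → ℂ} {h : E → F}
    (hg : Integrable g) (hh : Integrable h) : ∫ x, g x • 𝓕 h x = ∫ x, 𝓕 g x • h x := by
  have := VectorFourier.integral_fourierIntegral_smul_eq_flip (L := innerₗ E)
    Real.continuous_fourierChar continuous_inner hg hh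
  rw [flip_innerₗ] at this
  exact this.symm

theorem ae_eq_zero_of_fourier_eq_zero [NormedSpace ℂ F] [CompleteSpace F] {h : E → F}
    (hh : Integrable h) (h0 : ∀ ξ, 𝓕 h ξ = 0) : h =ᵐ[volume] 0 := by
  refine ae_eq_zero_of_integral_contDiff_smul_eq_zero hh.locallyIntegrable fun g hg hgc => ?_
  have hmul := integral_smul_fourier_eq (𝓕⁻ (testFunction hg hgc)).integrable hh
  rw [← SchwartzMap.fourier_coe, fourier_fourierInv_eq] at hmul
  simpa only [h0, smul_zero, integral_zero, testFunction_smul] using hmul.symm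

variable [InnerProductSpace ℂ F] [CompleteSpace F]

theorem coeFn_fourier_toLp {h : E → F} (h₁ : Integrable h) (h₂ : MemLp h 2) :
    (𝓕 (h₂.toLp h) : Lp F 2 (volume : Measure E)) =ᵐ[volume] 𝓕 h := by
  have hcont : Continuous (𝓕 h) := VectorFourier.fourierIntegral_continuous
    Real.continuous_fourierChar (by exact continuous_inner) h₁
  refine ae_eq_of_integral_contDiff_smul_eq
    ((Lp.memLp _).locallyIntegrable one_le_two) hcont.locallyIntegrable fun g hg hgc => ?_
  set G := testFunction hg hgc
  have hdist := congrArg (fun T => T G) (Lp.fourier_toTemperedDistribution_eq (h₂.toLp h))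
  simp only [TemperedDistribution.fourier_apply, Lp.toTemperedDistribution_apply] at hdist
  simp only [← testFunction_smul hg hgc]
  calc ∫ x, G x • (𝓕 (h₂.toLp h) : Lp F 2 (volume : Measure E)) x
      = ∫ x, 𝓕 G x • h₂.toLp h x := hdist.symm
    _ = ∫ x, 𝓕 G x • h x := by
      refine integral_congr_ae ?_
      filter_upwards [h₂.coeFn_toLp] with x hx
      rw [hx]
    _ = ∫ x, G x • 𝓕 h x := by
      rw [integral_smul_fourier_eq G.integrable h₁, SchwartzMap.fourier_coe]

theorem eLpNorm_fourier {h : E → F} (h₁ : Integrable h) (h₂ : MemLp h 2) :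
    eLpNorm (𝓕 h) 2 = eLpNorm h 2 := by
  rw [← eLpNorm_congr_ae (coeFn_fourier_toLp h₁ h₂), ← eLpNorm_congr_ae h₂.coeFn_toLp,
    ← Lp.enorm_def, ← Lp.enorm_def, ← ofReal_norm, ← ofReal_norm, Lp.norm_fourier_eq]

end Fourier

section MoyalFrame

variable {ι X E : Type*} [MeasurableSpace X] {μ : Measure X} [NormedAddCommGroup E]
  [InnerProductSpace ℂ E]

theorem integrable_mul_inner_of_memLp {f : X → ℂ} {u : X → E} {φ : E} (hf : MemLp f 2 μ)
    (hu : MemLp (fun x => ⟪u x, φ⟫_ℂ) 2 μ) : Integrable (fun x => f x * ⟪φ, u x⟫_ℂ) μ := by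
  simpa only [Pi.mul_def, Pi.star_apply, RCLike.star_def, inner_conj_symm] using
    hf.integrable_mul hu.star

/-- A family of bounded operators, indexed by a measure space, whose matrix elements satisfy the
orthogonality (Moyal) relations, stated here through their diagonal, and are total in `L²(μ)`. -/
structure IsMoyalFrame (N : X → E →L[ℂ] E) (μ : Measure X) : Prop where
  aestronglyMeasurable (φ ψ : E) : AEStronglyMeasurable (fun x => ⟪N x ψ, φ⟫_ℂ) μ
  eLpNorm_eq (φ ψ : E) : eLpNorm (fun x => ⟪N x ψ, φ⟫_ℂ) 2 μ = ENNReal.ofReal (‖φ‖ * ‖ψ‖)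
  ae_eq_zero (f : X → ℂ) (hf : MemLp f 2 μ) (h : ∀ φ ψ, ∫ x, f x * ⟪φ, N x ψ⟫_ℂ ∂μ = 0) :
    f =ᵐ[μ] 0

namespace IsMoyalFrame

variable {N : X → E →L[ℂ] E}

theorem memLp (hN : IsMoyalFrame N μ) (φ ψ : E) : MemLp (fun x => ⟪N x ψ, φ⟫_ℂ) 2 μ :=
  ⟨hN.aestronglyMeasurable φ ψ, hN.eLpNorm_eq φ ψ ▸ ENNReal.ofReal_lt_top⟩

/-- The matrix element `x ↦ ⟪N x ψ, φ⟫` as an element of `L²(μ)`, antilinear in `ψ` (which comes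
first) and linear in `φ`. -/
def coeff (hN : IsMoyalFrame N μ) : E →L⋆[ℂ] E →L[ℂ] Lp ℂ 2 μ :=
  LinearMap.mkContinuous₂
    (LinearMap.mk₂'ₛₗ (starRingEnd ℂ) (RingHom.id ℂ) (fun ψ φ => (hN.memLp φ ψ).toLp _)
      (fun ψ₁ ψ₂ φ => by
        simp only [← MemLp.toLp_add, map_add, inner_add_left, Pi.add_def])
      (fun c ψ φ => by
        simp only [← MemLp.toLp_const_smul, map_smul, inner_smul_left, Pi.smul_def, smul_eq_mul])
      (fun ψ φ₁ φ₂ => by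
        simp only [← MemLp.toLp_add, inner_add_right, Pi.add_def])
      (fun c ψ φ => by
        simp only [← MemLp.toLp_const_smul, inner_smul_right, Pi.smul_def, smul_eq_mul,
          RingHom.id_apply]))
    1 fun ψ φ => by
      change ‖(hN.memLp φ ψ).toLp _‖ ≤ _
      rw [Lp.norm_toLp, hN.eLpNorm_eq, ENNReal.toReal_ofReal (by positivity)]
      exact le_of_eq (by ring)

theorem coeFn_coeff (hN : IsMoyalFrame N μ) (ψ φ : E) :
    hN.coeff ψ φ =ᵐ[μ] fun x => ⟪N x ψ, φ⟫_ℂ :=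
  MemLp.coeFn_toLp (hN.memLp φ ψ)

theorem norm_coeff (hN : IsMoyalFrame N μ) (ψ φ : E) : ‖hN.coeff ψ φ‖ = ‖φ‖ * ‖ψ‖ := by
  rw [Lp.norm_def, eLpNorm_congr_ae (hN.coeFn_coeff ψ φ), hN.eLpNorm_eq,
    ENNReal.toReal_ofReal (by positivity)]

theorem continuous_coeff (hN : IsMoyalFrame N μ) : Continuous fun p : E × E => hN.coeff p.1 p.2 :=
  (hN.coeff.continuous.comp continuous_fst).clm_apply continuous_snd

theorem inner_coeff_self_left (hN : IsMoyalFrame N μ) (ψ φ₁ φ₂ : E) :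
    ⟪hN.coeff ψ φ₁, hN.coeff ψ φ₂⟫_ℂ = ⟪φ₁, φ₂⟫_ℂ * ⟪ψ, ψ⟫_ℂ := by
  rw [inner_eq_sum_norm_sq_div_four, ← map_add, ← map_sub, ← map_smul, ← map_sub, ← map_add]
  simp only [norm_coeff]
  rw [inner_eq_sum_norm_sq_div_four φ₁ φ₂, inner_self_eq_norm_sq_to_K]
  push_cast
  simp only [Complex.coe_algebraMap]
  ring

-- Polarization of `inner_coeff_self_left` in `ψ`.
theorem inner_coeff (hN : IsMoyalFrame N μ) (ψ₁ φ₁ ψ₂ φ₂ : E) :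
    ⟪hN.coeff ψ₁ φ₁, hN.coeff ψ₂ φ₂⟫_ℂ = ⟪φ₁, φ₂⟫_ℂ * ⟪ψ₂, ψ₁⟫_ℂ := by
  have h₁ := hN.inner_coeff_self_left (ψ₁ + ψ₂) φ₁ φ₂
  have h₂ := hN.inner_coeff_self_left (ψ₁ + Complex.I • ψ₂) φ₁ φ₂
  have h₃ := hN.inner_coeff_self_left ψ₁ φ₁ φ₂
  have h₄ := hN.inner_coeff_self_left ψ₂ φ₁ φ₂
  simp only [map_add, map_smulₛₗ, add_apply, smul_apply, inner_add_left, inner_add_right,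
    inner_smul_left, inner_smul_right, Complex.conj_I, h₃, h₄, map_neg] at h₁ h₂
  linear_combination (1 / 2 : ℂ) * h₁ + (Complex.I / 2) * h₂ + (1 / 2 : ℂ) *
    (⟪hN.coeff ψ₁ φ₁, hN.coeff ψ₂ φ₂⟫_ℂ - ⟪hN.coeff ψ₂ φ₁, hN.coeff ψ₁ φ₂⟫_ℂ
      - ⟪φ₁, φ₂⟫_ℂ * ⟪ψ₂, ψ₁⟫_ℂ + ⟪φ₁, φ₂⟫_ℂ * ⟪ψ₁, ψ₂⟫_ℂ) * Complex.I_sq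

theorem orthonormal_coeff (hN : IsMoyalFrame N μ) (b : HilbertBasis ι ℂ E) :
    Orthonormal ℂ fun p : ι × ι => hN.coeff (b p.1) (b p.2) := by
  classical
  rw [orthonormal_iff_ite]
  rintro ⟨m, n⟩ ⟨m', n'⟩
  have h := orthonormal_iff_ite.1 b.orthonormal
  rw [inner_coeff, h, h]
  by_cases hm : m = m' <;> by_cases hn : n = n' <;> simp [hm, hn, eq_comm (a := m')]

theorem inner_coeff_toLp (hN : IsMoyalFrame N μ) (ψ φ : E) {f : X → ℂ} (hf : MemLp f 2 μ) :
    ⟪hN.coeff ψ φ, hf.toLp f⟫_ℂ = ∫ x, f x * ⟪φ, N x ψ⟫_ℂ ∂μ := by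
  rw [L2.inner_def]
  refine integral_congr_ae ?_
  filter_upwards [hN.coeFn_coeff ψ φ, hf.coeFn_toLp] with x hx hfx
  rw [hx, hfx, RCLike.inner_apply, inner_conj_symm]

theorem integrable_mul_inner (hN : IsMoyalFrame N μ) {f : X → ℂ} (hf : MemLp f 2 μ) (φ ψ : E) :
    Integrable (fun x => f x * ⟪φ, N x ψ⟫_ℂ) μ :=
  integrable_mul_inner_of_memLp hf (hN.memLp φ ψ)

variable [CompleteSpace E]

/-- The operator `∫ f(x) N(x) dμ(x)`. -/
def op (hN : IsMoyalFrame N μ) : Lp ℂ 2 μ →L[ℂ] E →L[ℂ] E :=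
  (ContinuousLinearMap.comp (ContinuousLinearMap.adjoint (𝕜 := ℂ) (E := E)
    (F := Lp ℂ 2 μ)).toContinuousLinearEquiv.toContinuousLinearMap hN.coeff).flip

theorem inner_op (hN : IsMoyalFrame N μ) (f : Lp ℂ 2 μ) (φ ψ : E) :
    ⟪φ, hN.op f ψ⟫_ℂ = ⟪hN.coeff ψ φ, f⟫_ℂ :=
  ContinuousLinearMap.adjoint_inner_right (hN.coeff ψ) φ f

theorem op_eq_iff (hN : IsMoyalFrame N μ) {f : X → ℂ} (hf : MemLp f 2 μ) (A : E →L[ℂ] E) :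
    hN.op (hf.toLp f) = A ↔ ∀ φ ψ, Integrable (fun x => f x * ⟪φ, N x ψ⟫_ℂ) μ ∧
      ⟪φ, A ψ⟫_ℂ = ∫ x, f x * ⟪φ, N x ψ⟫_ℂ ∂μ := by
  have hop (φ ψ : E) : ⟪φ, hN.op (hf.toLp f) ψ⟫_ℂ = ∫ x, f x * ⟪φ, N x ψ⟫_ℂ ∂μ := by
    rw [inner_op, inner_coeff_toLp]
  refine ⟨fun h φ ψ => ⟨hN.integrable_mul_inner hf φ ψ, h ▸ hop φ ψ⟩, fun h => ?_⟩
  ext1 ψ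
  exact ext_inner_left ℂ fun φ => (hop φ ψ).trans (h φ ψ).2.symm

theorem op_injective (hN : IsMoyalFrame N μ) : Function.Injective hN.op := by
  refine (injective_iff_map_eq_zero hN.op).2 fun f hf => ?_
  rw [Lp.eq_zero_iff_ae_eq_zero]
  refine hN.ae_eq_zero f (Lp.memLp f) fun φ ψ => ?_
  rw [← hN.inner_coeff_toLp ψ φ (Lp.memLp f), Lp.toLp_coeFn, ← inner_op, hf,
    zero_apply, inner_zero_right]

/-- The orthonormal basis of `L²(μ)` formed by the matrix elements with respect to an orthonormal
basis of the Hilbert space. -/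
def basis (hN : IsMoyalFrame N μ) (b : HilbertBasis ι ℂ E) :
    HilbertBasis (ι × ι) ℂ (Lp ℂ 2 μ) :=
  HilbertBasis.mkOfOrthogonalEqBot (hN.orthonormal_coeff b) <| by
    refine (Submodule.eq_bot_iff _).2 fun f hf => hN.op_injective ?_
    refine continuousLinearMap_ext_hilbertBasis b b fun m n => ?_
    rw [inner_op, inner_op, inner_zero_right]
    exact (Submodule.mem_orthogonal _ _).1 hf _ (Submodule.subset_span ⟨(m, n), rfl⟩)

theorem basis_apply (hN : IsMoyalFrame N μ) (b : HilbertBasis ι ℂ E) (p : ι × ι) :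
    hN.basis b p = hN.coeff (b p.1) (b p.2) := by
  rw [basis, HilbertBasis.coe_mkOfOrthogonalEqBot]

theorem hasSum_inner_op (hN : IsMoyalFrame N μ) (b : HilbertBasis ι ℂ E) (f g : Lp ℂ 2 μ) :
    HasSum (fun n => ⟪hN.op f (b n), hN.op g (b n)⟫_ℂ) ⟪f, g⟫_ℂ := by
  refine ((hN.basis b).hasSum_inner_mul_inner f g).prod_fiberwise fun n => ?_
  convert b.hasSum_inner_mul_inner (hN.op f (b n)) (hN.op g (b n)) using 2 with m
  rw [basis_apply, ← inner_op, ← inner_conj_symm f, ← inner_op, inner_conj_symm]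

theorem hasSum_coeff_op (hN : IsMoyalFrame N μ) (b : HilbertBasis ι ℂ E) (f : Lp ℂ 2 μ) :
    HasSum (fun n => hN.coeff (b n) (hN.op f (b n))) f := by
  refine ((hN.basis b).hasSum_repr f).prod_fiberwise fun n => ?_
  convert (b.hasSum_repr (hN.op f (b n))).mapL (hN.coeff (b n)) using 2 with m
  rw [HilbertBasis.repr_apply_apply, HilbertBasis.repr_apply_apply, basis_apply, inner_op, map_smul]

theorem tendsto_eLpNorm_sum_inner_op (hN : IsMoyalFrame N μ) (b : HilbertBasis ι ℂ E)
    (f : Lp ℂ 2 μ) : Tendsto (fun s : Finset ι =>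
      eLpNorm (fun x => (∑ n ∈ s, ⟪N x (b n), hN.op f (b n)⟫_ℂ) - f x) 2 μ) atTop (𝓝 0) := by
  have hlim := (Lp.tendsto_Lp_iff_tendsto_eLpNorm' _ _).1 (hN.hasSum_coeff_op b f)
  refine hlim.congr fun s => eLpNorm_congr_ae ?_
  filter_upwards [Lp.coeFn_finsetSum s fun n => hN.coeff (b n) (hN.op f (b n)),
    (ae_ball_iff s.countable_toSet).2 fun n _ => hN.coeFn_coeff (b n) (hN.op f (b n))] with x hx hn
  rw [Pi.sub_apply, hx, Finset.sum_apply, Finset.sum_congr rfl hn]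

theorem ae_eq_of_hasSum_inner_op (hN : IsMoyalFrame N μ) (b : HilbertBasis ℕ ℂ E)
    {f : Lp ℂ 2 μ} {W : X → ℂ} (hW : ∀ x, HasSum (fun n => ⟪N x (b n), hN.op f (b n)⟫_ℂ) (W x)) :
    W =ᵐ[μ] f :=
  (ae_eq_of_tendsto_eLpNorm_of_tendsto two_ne_zero
    (fun k => Finset.aestronglyMeasurable_fun_sum (Finset.range k) fun n _ =>
      hN.aestronglyMeasurable (hN.op f (b n)) (b n)) (Lp.aestronglyMeasurable f)
    ((hN.tendsto_eLpNorm_sum_inner_op b f).comp tendsto_finset_range)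
    (.of_forall fun x => (hW x).tendsto_sum_nat)).symm

theorem exists_op_eq (hN : IsMoyalFrame N μ) (b : HilbertBasis ι ℂ E) {A : E →L[ℂ] E}
    (hA : Summable fun n => ‖A (b n)‖ ^ 2) : ∃ f, hN.op f = A := by
  have hmem : Memℓp (fun p : ι × ι => ⟪b p.2, A (b p.1)⟫_ℂ) 2 :=
    memℓp_gen (by simpa using (hasSum_norm_inner_apply_sq b b hA.hasSum).summable)
  refine ⟨(hN.basis b).repr.symm ⟨_, hmem⟩, continuousLinearMap_ext_hilbertBasis b b fun n m => ?_⟩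
  rw [inner_op, ← hN.basis_apply b (n, m), ← (hN.basis b).repr_apply_apply,
    LinearIsometryEquiv.apply_symm_apply]

theorem of_unitary {Y : Type*} [MeasurableSpace Y] {ν : Measure Y} {N' : Y → E →L[ℂ] E}
    (hN : IsMoyalFrame N μ) (U : Lp ℂ 2 μ ≃ₗᵢ[ℂ] Lp ℂ 2 ν) {V : Set E} (hV : Dense V)
    (h : ∀ φ ∈ V, ∀ ψ ∈ V, U (hN.coeff ψ φ) =ᵐ[ν] fun y => ⟪N' y ψ, φ⟫_ℂ) :
    IsMoyalFrame N' ν := by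
  have hU (φ ψ : E) : U (hN.coeff ψ φ) =ᵐ[ν] fun y => ⟪N' y ψ, φ⟫_ℂ := by
    obtain ⟨u, huV, hu⟩ := mem_closure_iff_seq_limit.1 (hV φ)
    obtain ⟨v, hvV, hv⟩ := mem_closure_iff_seq_limit.1 (hV ψ)
    have hlim : Tendsto (fun n => U (hN.coeff (v n) (u n))) atTop (𝓝 (U (hN.coeff ψ φ))) := by
      have hcont := U.continuous.comp hN.continuous_coeff
      simpa only [Function.comp_def] using (hcont.tendsto (ψ, φ)).comp (hv.prodMk_nhds hu)
    refine ae_eq_of_tendsto_eLpNorm_of_tendsto two_ne_zero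
      (fun n => Lp.aestronglyMeasurable _) (Lp.aestronglyMeasurable _)
      ((Lp.tendsto_Lp_iff_tendsto_eLpNorm' _ _).1 hlim) ?_
    filter_upwards [ae_all_iff.2 fun n => h _ (huV n) _ (hvV n)] with y hy
    simp only [hy]
    exact (((N' y).continuous.tendsto ψ).comp hv).inner hu
  refine ⟨fun φ ψ => (Lp.aestronglyMeasurable _).congr (hU φ ψ), fun φ ψ => ?_,
    fun f hf h0 => ?_⟩
  · rw [← eLpNorm_congr_ae (hU φ ψ), ← Lp.enorm_def, ← ofReal_norm, U.norm_map, norm_coeff]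
  · suffices hsymm : U.symm (hf.toLp f) = 0 by
      rw [LinearIsometryEquiv.map_eq_zero_iff, Lp.eq_zero_iff_ae_eq_zero] at hsymm
      exact hf.coeFn_toLp.symm.trans hsymm
    refine hN.op_injective (ContinuousLinearMap.ext fun ψ => ext_inner_left ℂ fun φ => ?_)
    rw [map_zero, zero_apply, inner_zero_right, inner_op, ← LinearIsometryEquiv.inner_map_eq_flip,
      L2.inner_def, ← h0 φ ψ]
    refine integral_congr_ae ?_
    filter_upwards [hU φ ψ, hf.coeFn_toLp] with y hy hfy
    rw [hy, hfy, RCLike.inner_apply, inner_conj_symm]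

end IsMoyalFrame

end MoyalFrame

section Displacement

open Real (probChar)

/-- The symplectic form `2 Im (z̄ w)` on the phase space, normalized so that its exponential is the
commutation phase of the displacement operators. -/
def symplecticForm : ℂ →ₗ[ℝ] ℂ →ₗ[ℝ] ℝ :=
  LinearMap.mk₂ ℝ (fun z w => 2 * (z.re * w.im - z.im * w.re))
    (fun _ _ _ => by
      simp only [Complex.add_re, Complex.add_im]
      ring)
    (fun _ _ _ => by
      simp only [Complex.smul_re, Complex.smul_im, smul_eq_mul]
      ring)
    (fun _ _ _ => by
      simp only [Complex.add_re, Complex.add_im]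
      ring)
    (fun _ _ _ => by
      simp only [Complex.smul_re, Complex.smul_im, smul_eq_mul]
      ring)

theorem symplecticForm_apply (z w : ℂ) :
    symplecticForm z w = 2 * (z.re * w.im - z.im * w.re) := rfl

theorem symplecticForm_flip : symplecticForm.flip = -symplecticForm := by
  ext z w
  simp only [LinearMap.flip_apply, LinearMap.neg_apply, symplecticForm_apply]
  ring

theorem continuous_symplecticForm : Continuous fun p : ℂ × ℂ => symplecticForm p.1 p.2 := by
  simp only [symplecticForm_apply]
  fun_prop

theorem displaceFun_displaceFun (u w : ℂ) (φ : ℝ → ℂ) (x : ℝ) :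
    displaceFun w (displaceFun u φ) x =
      probChar (symplecticForm u w) * displaceFun u (displaceFun w φ) x := by
  have h2 : √2 * √2 = (2 : ℝ) := Real.mul_self_sqrt zero_le_two
  simp only [displaceFun, Real.probChar_apply, ← mul_assoc, ← Complex.exp_add]
  rw [show x - pos w - pos u = x - pos u - pos w by ring]
  congr 2
  rw [← add_mul, ← add_mul, ← add_mul]
  congr 1
  norm_cast
  simp only [mom, pos, symplecticForm_apply]
  linear_combination (u.re * w.im - u.im * w.re) * h2

theorem displaceFun_neg_displaceFun (z : ℂ) (φ : ℝ → ℂ) :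
    displaceFun (-z) (displaceFun z φ) = φ := by
  have hpos : pos (-z) = -pos z := by simp [pos]
  have hmom : mom (-z) = -mom z := by simp [mom]
  ext x
  simp only [displaceFun, hpos, hmom, ← mul_assoc, ← Complex.exp_add, ← add_mul,
    ← Complex.ofReal_add, sub_neg_eq_add, add_sub_cancel_right]
  ring_nf
  simp

theorem D_comm (u w : ℂ) (φ : H) :
    D w (D u φ) = (probChar (symplecticForm u w) : ℂ) • D u (D w φ) := by
  refine Lp.ext ?_
  filter_upwards [D_coeFn w (D u φ), displaceFun_congr w (D_coeFn u φ), D_coeFn u (D w φ),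
    displaceFun_congr u (D_coeFn w φ),
    Lp.coeFn_smul (probChar (symplecticForm u w) : ℂ) (D u (D w φ))] with x h₁ h₂ h₃ h₄ h₅
  rw [h₁, h₂, h₅, Pi.smul_apply, h₃, h₄, displaceFun_displaceFun, smul_eq_mul]

theorem D_neg_apply (z : ℂ) (φ : H) : D (-z) (D z φ) = φ := by
  refine Lp.ext ?_
  filter_upwards [D_coeFn (-z) (D z φ), displaceFun_congr (-z) (D_coeFn z φ)] with x h₁ h₂
  rw [h₁, h₂, displaceFun_neg_displaceFun]

theorem inner_D_D (z : ℂ) (φ ψ : H) : ⟪D z φ, D z ψ⟫_ℂ = ⟪φ, ψ⟫_ℂ :=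
  (displacementIsometry z).inner_map_map φ ψ

theorem norm_D (z : ℂ) (φ : H) : ‖D z φ‖ = ‖φ‖ := (displacementIsometry z).norm_map φ

theorem adjoint_D (z : ℂ) : ContinuousLinearMap.adjoint (D z) = D (-z) := by
  refine ((ContinuousLinearMap.eq_adjoint_iff _ _).2 fun φ ψ => ?_).symm
  have hinv : D z (D (-z) φ) = φ := by simpa only [neg_neg] using D_neg_apply (-z) φ
  rw [← inner_D_D z, hinv]

theorem inner_D_conj (u w : ℂ) (φ ψ : H) :
    ⟪D u φ, D w (D u ψ)⟫_ℂ = probChar (symplecticForm u w) * ⟪φ, D w ψ⟫_ℂ := by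
  rw [D_comm, inner_smul_right, inner_D_D]

end Displacement

section MeasurableInner

theorem inner_D_left_eq (z : ℂ) (φ ψ : H) :
    ⟪D z ψ, φ⟫_ℂ = ∫ x, φ x * starRingEnd ℂ (displaceFun z ψ x) := by
  rw [L2.inner_def]
  refine integral_congr_ae ?_
  filter_upwards [D_coeFn z ψ] with x hx
  rw [hx, RCLike.inner_apply]

theorem measurable_inner_D_left (φ ψ : H) : Measurable fun z => ⟪D z ψ, φ⟫_ℂ := by
  have hφ := (Lp.stronglyMeasurable φ).measurable
  have hψ := (Lp.stronglyMeasurable ψ).measurable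
  have hdisplace : Measurable fun p : ℂ × ℝ => displaceFun p.1 ψ p.2 := by
    unfold displaceFun mom pos
    fun_prop
  have hint : Measurable fun p : ℂ × ℝ => φ p.2 * starRingEnd ℂ (displaceFun p.1 ψ p.2) := by
    fun_prop
  simp_rw [inner_D_left_eq]
  exact hint.stronglyMeasurable.integral_prod_right.measurable

end MeasurableInner

section MoyalIdentity

open FourierTransform

theorem lintegral_comp_mul_right (f : ℝ → ℝ≥0∞) {c : ℝ} (hc : c ≠ 0) :
    ∫⁻ x, f (x * c) = ENNReal.ofReal |c⁻¹| * ∫⁻ x, f x := by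
  rw [← smul_eq_mul, ← lintegral_smul_measure, ← Real.map_volume_mul_right hc]
  exact (lintegral_map_equiv f (MeasurableEquiv.mulRight₀ c hc)).symm

theorem lintegral_lintegral_mul_comp_sub {G : Type*} [AddCommGroup G] [MeasurableSpace G]
    [MeasurableAdd₂ G] [MeasurableNeg G] {μ : Measure G} [SFinite μ] [μ.IsAddLeftInvariant]
    [μ.IsNegInvariant] {f g : G → ℝ≥0∞} (hf : Measurable f) (hg : Measurable g) :
    ∫⁻ q, ∫⁻ x, f x * g (x - q) ∂μ ∂μ = (∫⁻ x, f x ∂μ) * ∫⁻ x, g x ∂μ := by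
  rw [lintegral_lintegral_swap (by fun_prop)]
  have hinner (x : G) : ∫⁻ q, f x * g (x - q) ∂μ = f x * ∫⁻ q, g q ∂μ := by
    rw [lintegral_const_mul _ (by fun_prop), lintegral_sub_left_eq_self g x]
  simp_rw [hinner]
  rw [lintegral_mul_const _ hf]

theorem lintegral_complex {f : ℂ → ℝ≥0∞} (hf : Measurable f) :
    ∫⁻ z, f z = ∫⁻ a : ℝ, ∫⁻ b : ℝ, f ⟨a, b⟩ := by
  rw [← Complex.volume_preserving_equiv_real_prod.symm.lintegral_comp hf, Measure.volume_eq_prod,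
    lintegral_prod _ (by fun_prop)]
  rfl

-- `q` and `ξ` are position and frequency `p / 2π`, in which `d²z / π` becomes `dq dξ`.
theorem lintegral_phaseMeasure {f : ℂ → ℝ≥0∞} (hf : Measurable f) :
    ∫⁻ z, f z ∂phaseMeasure =
      ∫⁻ q : ℝ, ∫⁻ ξ : ℝ, f ⟨q * (√2)⁻¹, ξ * (√2 * Real.pi)⟩ := by
  have h2 : 0 < √2 := by positivity
  have hπ := Real.pi_pos
  have hmeas : Measurable fun a : ℝ => ∫⁻ b : ℝ, f ⟨a, b⟩ :=
    (hf.comp Complex.measurableEquivRealProd.symm.measurable).lintegral_prod_right'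
  simp_rw [fun q : ℝ => lintegral_comp_mul_right (fun b => f ⟨q * (√2)⁻¹, b⟩)
    (mul_pos h2 hπ).ne']
  rw [lintegral_const_mul _ (f := fun q : ℝ => ∫⁻ b : ℝ, f ⟨q * (√2)⁻¹, b⟩)
      (hmeas.comp (measurable_id.mul_const _)),
    lintegral_comp_mul_right (fun a => ∫⁻ b : ℝ, f ⟨a, b⟩) (inv_pos.2 h2).ne',
    ← lintegral_complex hf, phaseMeasure, lintegral_smul_measure, smul_eq_mul, ← mul_assoc,
    ← ENNReal.ofReal_mul (abs_nonneg _), ← abs_mul, mul_inv, mul_right_comm,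
    inv_inv, inv_mul_cancel₀ h2.ne', one_mul, abs_of_pos (inv_pos.2 hπ)]

theorem inner_D_left_eq_fourier (z : ℂ) (φ ψ : H) :
    ⟪D z ψ, φ⟫_ℂ = Complex.exp (((mom z * pos z / 2 : ℝ) : ℂ) * Complex.I) *
      𝓕 (fun x : ℝ => φ x * starRingEnd ℂ (ψ (x - pos z))) (mom z / (2 * Real.pi)) := by
  have hphase (x : ℝ) : Complex.exp (((mom z * (x - pos z / 2) : ℝ) : ℂ) * -Complex.I) =
      Complex.exp (((mom z * pos z / 2 : ℝ) : ℂ) * Complex.I) *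
        Complex.exp (((-2 * Real.pi * x * (mom z / (2 * Real.pi)) : ℝ) : ℂ) * Complex.I) := by
    rw [← Complex.exp_add]
    congr 1
    push_cast
    field_simp
    ring
  rw [inner_D_left_eq, Real.fourier_real_eq_integral_exp_smul, ← integral_const_mul]
  refine integral_congr_ae (Eventually.of_forall fun x => ?_)
  simp only [displaceFun, map_mul, ← Complex.exp_conj, Complex.conj_I, Complex.conj_ofReal,
    smul_eq_mul, hphase]
  ring

theorem enorm_inner_D_left (q ξ : ℝ) (φ ψ : H) :
    ‖⟪D ⟨q * (√2)⁻¹, ξ * (√2 * Real.pi)⟩ ψ, φ⟫_ℂ‖ₑ =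
      ‖𝓕 (fun x : ℝ => φ x * starRingEnd ℂ (ψ (x - q))) ξ‖ₑ := by
  have h2 : √2 * √2 = (2 : ℝ) := Real.mul_self_sqrt zero_le_two
  have hpos : pos ⟨q * (√2)⁻¹, ξ * (√2 * Real.pi)⟩ = q := by
    simp only [pos]
    field_simp
  have hmom : mom ⟨q * (√2)⁻¹, ξ * (√2 * Real.pi)⟩ / (2 * Real.pi) = ξ := by
    simp only [mom]
    field_simp
    linear_combination ξ * h2
  rw [inner_D_left_eq_fourier, hpos, hmom, enorm_mul, ← ofReal_norm (Complex.exp _),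
    Complex.norm_exp_ofReal_mul_I, ENNReal.ofReal_one, one_mul]

theorem lintegral_lintegral_enorm_mul_conj_sq (φ ψ : H) :
    ∫⁻ q, ∫⁻ x, ‖φ x * starRingEnd ℂ (ψ (x - q))‖ₑ ^ 2 = (‖φ‖ₑ * ‖ψ‖ₑ) ^ 2 := by
  have hφ := (Lp.stronglyMeasurable φ).measurable
  have hψ := (Lp.stronglyMeasurable ψ).measurable
  simp_rw [enorm_mul, RCLike.enorm_conj, mul_pow]
  rw [lintegral_lintegral_mul_comp_sub (f := fun x => ‖φ x‖ₑ ^ 2) (g := fun x => ‖ψ x‖ₑ ^ 2)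
    (hφ.enorm.pow_const 2) (hψ.enorm.pow_const 2), ← eLpNorm_two_sq, ← eLpNorm_two_sq,
    Lp.enorm_def, Lp.enorm_def]

theorem ae_memLp_mul_conj_translate (φ ψ : H) :
    ∀ᵐ q : ℝ, MemLp (fun x => φ x * starRingEnd ℂ (ψ (x - q))) 2 := by
  have hφ := (Lp.stronglyMeasurable φ).measurable
  have hψ := (Lp.stronglyMeasurable ψ).measurable
  have hmeas : Measurable fun p : ℝ × ℝ => φ p.2 * starRingEnd ℂ (ψ (p.2 - p.1)) := by
    fun_prop
  have hfin := lintegral_lintegral_enorm_mul_conj_sq φ ψ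
  filter_upwards [ae_lt_top (hmeas.enorm.pow_const 2).lintegral_prod_right'
    (hfin.trans_lt (by finiteness)).ne] with q hq
  refine ⟨(hmeas.comp measurable_prodMk_left).aestronglyMeasurable, ?_⟩
  rw [← eLpNorm_two_sq] at hq
  exact (ENNReal.pow_lt_top_iff.1 hq).resolve_right two_ne_zero

theorem integrable_mul_conj_translate (φ ψ : H) (q : ℝ) :
    Integrable fun x => φ x * starRingEnd ℂ (ψ (x - q)) :=
  (Lp.memLp φ).integrable_mul
    ((Lp.memLp ψ).comp_measurePreserving (measurePreserving_sub_right volume q)).star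

theorem eLpNorm_inner_D (φ ψ : H) :
    eLpNorm (fun z => ⟪D z ψ, φ⟫_ℂ) 2 phaseMeasure = ENNReal.ofReal (‖φ‖ * ‖ψ‖) := by
  rw [ENNReal.ofReal_mul (norm_nonneg _), ofReal_norm, ofReal_norm, eLpNorm_two_eq_iff,
    lintegral_phaseMeasure ((measurable_inner_D_left φ ψ).enorm.pow_const 2),
    ← lintegral_lintegral_enorm_mul_conj_sq]
  simp_rw [enorm_inner_D_left]
  refine lintegral_congr_ae ?_
  filter_upwards [ae_memLp_mul_conj_translate φ ψ] with q hq
  rw [← eLpNorm_two_sq, ← eLpNorm_two_sq,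
    eLpNorm_fourier (integrable_mul_conj_translate φ ψ q) hq]

end MoyalIdentity

section SymplecticFourier

open Real (probChar)
open FourierTransform

theorem volume_eq_smul_phaseMeasure :
    (volume : Measure ℂ) = ENNReal.ofReal Real.pi • phaseMeasure := by
  rw [phaseMeasure, smul_smul, ← ENNReal.ofReal_mul Real.pi_pos.le,
    mul_inv_cancel₀ Real.pi_ne_zero, ENNReal.ofReal_one, one_smul]

theorem integrable_phaseMeasure_iff {f : ℂ → ℂ} :
    Integrable f phaseMeasure ↔ Integrable f := by
  rw [phaseMeasure, integrable_smul_measure (by simp [Real.pi_pos]) (by simp)]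

theorem memLp_phaseMeasure_iff {f : ℂ → ℂ} {p : ℝ≥0∞} :
    MemLp f p phaseMeasure ↔ MemLp f p := by
  refine ⟨fun h => ?_, fun h => h.smul_measure ENNReal.ofReal_ne_top⟩
  rw [volume_eq_smul_phaseMeasure]
  exact h.smul_measure ENNReal.ofReal_ne_top

theorem ae_phaseMeasure_eq : ae phaseMeasure = ae volume :=
  Measure.ae_ennreal_smul_measure_eq (by simp [Real.pi_pos]) _

theorem integral_phaseMeasure (f : ℂ → ℂ) :
    ∫ z, f z ∂phaseMeasure = (Real.pi : ℂ)⁻¹ * ∫ z, f z := by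
  rw [phaseMeasure, integral_smul_measure, ENNReal.toReal_ofReal (by positivity),
    Complex.real_smul, Complex.ofReal_inv]

instance : SigmaFinite phaseMeasure :=
  inferInstanceAs (SigmaFinite (Real.pi⁻¹.toNNReal • (volume : Measure ℂ)))

/-- The Fourier transform `z ↦ ∫ e^{i σ(z, w)} h(w) d²w/π` for the symplectic form `σ`. -/
def symplecticFourier (h : ℂ → ℂ) : ℂ → ℂ :=
  VectorFourier.fourierIntegral probChar phaseMeasure symplecticForm h

theorem symplecticFourier_apply (h : ℂ → ℂ) (z : ℂ) :
    symplecticFourier h z = ∫ w, probChar (symplecticForm z w) * h w ∂phaseMeasure := by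
  have hflip (w : ℂ) : -symplecticForm w z = symplecticForm z w := by
    simp only [symplecticForm_apply]
    ring
  simp only [symplecticFourier, VectorFourier.fourierIntegral, Circle.smul_def, smul_eq_mul, hflip]

theorem integral_mul_symplecticFourier_neg {f h : ℂ → ℂ} (hf : Integrable f phaseMeasure)
    (hh : Integrable h phaseMeasure) :
    ∫ z, f z * symplecticFourier h (-z) ∂phaseMeasure =
      ∫ w, symplecticFourier f w * h w ∂phaseMeasure := by
  have := VectorFourier.integral_fourierIntegral_smul_eq_flip Real.continuous_probChar
    continuous_symplecticForm hf hh
  simp only [smul_eq_mul, symplecticForm_flip] at this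
  refine Eq.trans ?_ this.symm
  simp [VectorFourier.fourierIntegral, symplecticFourier]

theorem continuous_symplecticFourier {h : ℂ → ℂ} (hh : Integrable h phaseMeasure) :
    Continuous (symplecticFourier h) :=
  VectorFourier.fourierIntegral_continuous Real.continuous_probChar continuous_symplecticForm hh

/-- The linear change of variables turning the Euclidean Fourier transform of the plane into the
symplectic one. -/
def dualPoint : ℂ ≃ᵐ ℂ :=
  MeasurableEquiv.mulLeft₀ (-(Complex.I / Real.pi))
    (neg_ne_zero.2 (div_ne_zero Complex.I_ne_zero (Complex.ofReal_ne_zero.2 Real.pi_ne_zero)))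

theorem dualPoint_apply (z : ℂ) : dualPoint z = -(Complex.I / Real.pi) * z := rfl

theorem map_dualPoint : phaseMeasure.map dualPoint = ENNReal.ofReal Real.pi • volume := by
  have hrot : MeasurePreserving (rotation (Circle.exp (-(Real.pi / 2))) : ℂ → ℂ) :=
    (rotation _).measurePreserving
  have hsmul := Measure.map_addHaar_smul (volume : Measure ℂ) (inv_ne_zero Real.pi_ne_zero)
  have hcomp : (dualPoint : ℂ → ℂ) =
      (fun z => Real.pi⁻¹ • z) ∘ (rotation (Circle.exp (-(Real.pi / 2))) : ℂ → ℂ) := by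
    funext z
    rw [Function.comp_apply, rotation_apply, Circle.coe_exp, Complex.ofReal_neg, neg_mul,
      Complex.exp_neg, Complex.ofReal_div, Complex.ofReal_ofNat, Complex.exp_pi_div_two_mul_I,
      Complex.inv_I, dualPoint_apply, Complex.real_smul, Complex.ofReal_inv]
    ring
  rw [phaseMeasure, Measure.map_smul, hcomp, ← Measure.map_map (by fun_prop) hrot.measurable,
    hrot.map_eq, hsmul, smul_smul, ← ENNReal.ofReal_mul (by positivity),
    Complex.finrank_real_complex, abs_of_pos (by positivity)]
  congr 2
  field_simp

theorem symplecticFourier_eq_fourier (h : ℂ → ℂ) (z : ℂ) :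
    symplecticFourier h z = (Real.pi : ℂ)⁻¹ * 𝓕 h (dualPoint z) := by
  have hphase (w : ℂ) : symplecticForm z w = -2 * Real.pi * ⟪w, dualPoint z⟫_ℝ := by
    rw [dualPoint_apply, Complex.inner, symplecticForm_apply]
    simp
    field_simp
    ring
  rw [symplecticFourier_apply, integral_phaseMeasure, Real.fourier_eq']
  simp only [hphase, Real.probChar_apply, smul_eq_mul]

theorem ae_eq_zero_of_symplecticFourier_eq_zero {h : ℂ → ℂ} (hh : Integrable h phaseMeasure)
    (h0 : ∀ z, symplecticFourier h z = 0) : h =ᵐ[phaseMeasure] 0 := by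
  rw [EventuallyEq, ae_phaseMeasure_eq]
  refine ae_eq_zero_of_fourier_eq_zero (integrable_phaseMeasure_iff.1 hh) fun ξ => ?_
  have := h0 (dualPoint.symm ξ)
  rw [symplecticFourier_eq_fourier, MeasurableEquiv.apply_symm_apply] at this
  exact (mul_eq_zero.1 this).resolve_left
    (inv_ne_zero (Complex.ofReal_ne_zero.2 Real.pi_ne_zero))

theorem enorm_inv_sqrt_pi_sq :
    ‖((√Real.pi : ℝ) : ℂ)⁻¹‖ₑ ^ 2 = ENNReal.ofReal Real.pi⁻¹ := by
  rw [← ofReal_norm, ← ENNReal.ofReal_pow (norm_nonneg _), norm_inv, Complex.norm_real,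
    inv_pow, Real.norm_eq_abs, sq_abs, Real.sq_sqrt Real.pi_pos.le]

theorem inv_sqrt_pi_ne_zero : ((√Real.pi : ℝ) : ℂ)⁻¹ ≠ 0 :=
  inv_ne_zero (Complex.ofReal_ne_zero.2 (Real.sqrt_pos.2 Real.pi_pos).ne')

theorem isUnitaryWeight_phaseMeasure :
    IsUnitaryWeight (MeasurableEquiv.refl ℂ) (fun _ => ((√Real.pi : ℝ) : ℂ)⁻¹) volume
      phaseMeasure :=
  .const inv_sqrt_pi_ne_zero <| by
    rw [enorm_inv_sqrt_pi_sq]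
    exact congrArg _ Measure.map_id

theorem isUnitaryWeight_dualPoint :
    IsUnitaryWeight dualPoint (fun _ => ((√Real.pi : ℝ) : ℂ)⁻¹) phaseMeasure volume :=
  .const inv_sqrt_pi_ne_zero <| by
    rw [enorm_inv_sqrt_pi_sq, map_dualPoint, smul_smul,
      ← ENNReal.ofReal_mul (inv_nonneg.2 Real.pi_pos.le), inv_mul_cancel₀ Real.pi_ne_zero,
      ENNReal.ofReal_one, one_smul]

/-- The symplectic Fourier transform as a unitary operator on `L²(ℂ, d²z/π)`. -/
def symplecticFourierₗᵢ : Lp ℂ 2 phaseMeasure ≃ₗᵢ[ℂ] Lp ℂ 2 phaseMeasure :=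
  isUnitaryWeight_phaseMeasure.unitary.trans <|
    (Lp.fourierTransformₗᵢ ℂ ℂ).trans isUnitaryWeight_dualPoint.unitary

theorem coeFn_symplecticFourierₗᵢ {h : ℂ → ℂ} (h₁ : Integrable h phaseMeasure)
    (h₂ : MemLp h 2 phaseMeasure) :
    symplecticFourierₗᵢ (h₂.toLp h) =ᵐ[phaseMeasure] symplecticFourier h := by
  have h₁' := integrable_phaseMeasure_iff.1 h₁
  have h₂' := memLp_phaseMeasure_iff.1 h₂
  have hscale : isUnitaryWeight_phaseMeasure.unitary (h₂.toLp h) =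
      ((√Real.pi : ℝ) : ℂ)⁻¹ • h₂'.toLp h := by
    refine Lp.ext ?_
    filter_upwards [isUnitaryWeight_phaseMeasure.coeFn_unitary (h₂.toLp h),
      ae_phaseMeasure_eq ▸ h₂.coeFn_toLp, h₂'.coeFn_toLp,
      Lp.coeFn_smul ((√Real.pi : ℝ) : ℂ)⁻¹ (h₂'.toLp h)] with x hU hx hx' hc
    rw [hU, MeasurableEquiv.refl_apply, hx, hc, Pi.smul_apply, hx', smul_eq_mul]
  have hfourier := isUnitaryWeight_dualPoint.quasiMeasurePreserving.ae_eq_comp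
    (coeFn_fourier_toLp h₁' h₂')
  have hsqrt : (√Real.pi : ℂ)⁻¹ * (√Real.pi : ℂ)⁻¹ = (Real.pi : ℂ)⁻¹ := by
    rw [← mul_inv, ← Complex.ofReal_mul, Real.mul_self_sqrt Real.pi_pos.le]
  simp only [symplecticFourierₗᵢ, LinearIsometryEquiv.trans_apply, hscale, map_smul]
  filter_upwards [hfourier, isUnitaryWeight_dualPoint.coeFn_unitary (𝓕 (h₂'.toLp h)),
    Lp.coeFn_smul ((√Real.pi : ℝ) : ℂ)⁻¹
      (isUnitaryWeight_dualPoint.unitary (𝓕 (h₂'.toLp h)))] with z hF hU hc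
  refine hc.trans ?_
  rw [Function.comp_apply, Function.comp_apply] at hF
  rw [Pi.smul_apply, hU, hF, smul_eq_mul, ← mul_assoc, hsqrt, symplecticFourier_eq_fourier]

end SymplecticFourier

section Totality

theorem exists_mem_ne_zero_of_dense {E : Type*} [TopologicalSpace E] [T1Space E] [Zero E]
    [Nontrivial E] {V : Set E} (hV : Dense V) : ∃ v ∈ V, v ≠ 0 := by
  obtain ⟨x, hx⟩ := exists_ne (0 : E)
  exact (hV.inter_open_nonempty _ isOpen_compl_singleton ⟨x, hx⟩).imp fun _ h => h.symm

theorem exists_countable_subset_forall_inner_ne_zero {𝕜 E : Type*} [RCLike 𝕜]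
    [NormedAddCommGroup E] [InnerProductSpace 𝕜 E] [TopologicalSpace.SeparableSpace E]
    {V : Set E} (hV : Dense V) :
    ∃ s ⊆ V, s.Countable ∧ ∀ v : E, v ≠ 0 → ∃ φ ∈ s, ⟪φ, v⟫_𝕜 ≠ 0 := by
  obtain ⟨s, hsV, hs, hd⟩ := hV.exists_countable_dense_subset
  refine ⟨s, hsV, hs, fun v hv => ?_⟩
  by_contra! h
  exact hv (hd.eq_zero_of_inner_right 𝕜 h)

theorem aestronglyMeasurable_of_mul {α ι : Type*} [MeasurableSpace α] {μ : Measure α}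
    [Countable ι] {w : α → ℂ} {c : ι → α → ℂ} (hc : ∀ i, Measurable (c i))
    (hwc : ∀ i, AEStronglyMeasurable (fun x => w x * c i x) μ) (h : ∀ x, ∃ i, c i x ≠ 0) :
    AEStronglyMeasurable w μ := by
  have hcover : ⋃ i, {x | c i x ≠ 0} = Set.univ :=
    Set.eq_univ_of_forall fun x => Set.mem_iUnion.2 (h x)
  rw [← Measure.restrict_univ (μ := μ), ← hcover, aestronglyMeasurable_iUnion_iff]
  intro i
  have hs : MeasurableSet {x | c i x ≠ 0} := hc i (measurableSet_singleton 0).compl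
  refine ((hwc i).restrict.mul (hc i).inv.aestronglyMeasurable).congr ?_
  filter_upwards [ae_restrict_mem hs] with x hx
  exact mul_inv_cancel_right₀ hx (w x)

instance : TopologicalSpace.SeparableSpace H :=
  have : Fact ((2 : ℝ≥0∞) ≠ ∞) := ⟨ENNReal.ofNat_ne_top⟩
  inferInstanceAs (TopologicalSpace.SeparableSpace (Lp ℂ 2 (volume : Measure ℝ)))

theorem not_finiteDimensional_H : ¬ FiniteDimensional ℂ H := by
  intro _
  have hμ (n : ℕ) : volume (Set.Ioc (n : ℝ) (n + 1)) ≠ ∞ := measure_Ioc_lt_top.ne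
  have ho : Orthonormal ℂ fun n : ℕ =>
      (indicatorConstLp 2 measurableSet_Ioc (hμ n) (1 : ℂ) : H) := by
    rw [orthonormal_iff_ite]
    intro m n
    rw [L2.inner_indicatorConstLp_one_indicatorConstLp_one measurableSet_Ioc measurableSet_Ioc
      (hμ m) (hμ n)]
    split_ifs with hmn
    · simp [hmn, Measure.real]
    · have hd : Disjoint (Set.Ioc (m : ℝ) (m + 1)) (Set.Ioc (n : ℝ) (n + 1)) := by
        simpa using Set.pairwise_disjoint_Ioc_intCast ℝ (Int.ofNat_injective.ne hmn)
      simp [hd.inter_eq]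
  exact not_finite_iff_infinite.2 (inferInstance : Infinite ℕ) ho.linearIndependent.finite

instance : Nontrivial H :=
  not_subsingleton_iff_nontrivial.1 fun _ => not_finiteDimensional_H inferInstance

theorem D_ne_zero (z : ℂ) {φ : H} (hφ : φ ≠ 0) : D z φ ≠ 0 :=
  norm_ne_zero_iff.1 (norm_D z φ ▸ norm_ne_zero_iff.2 hφ)

variable {V : Submodule ℂ H}

theorem exists_countable_forall_inner_D_ne_zero (hd : Dense (V : Set H)) :
    ∃ ψ ∈ V, ∃ s ⊆ (V : Set H), s.Countable ∧ ∀ z, ∃ φ ∈ s, ⟪φ, D z ψ⟫_ℂ ≠ 0 := by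
  obtain ⟨ψ, hψ, hψ0⟩ := exists_mem_ne_zero_of_dense hd
  obtain ⟨s, hsV, hs, hs0⟩ := exists_countable_subset_forall_inner_ne_zero (𝕜 := ℂ) hd
  exact ⟨ψ, hψ, s, hsV, hs, fun z => hs0 _ (D_ne_zero z hψ0)⟩

theorem integral_mul_inner_D_conj (g : ℂ → ℂ) (z : ℂ) (φ ψ : H) :
    ∫ w, g w * ⟪D z φ, D w (D z ψ)⟫_ℂ ∂phaseMeasure =
      symplecticFourier (fun w => g w * ⟪φ, D w ψ⟫_ℂ) z := by
  rw [symplecticFourier_apply]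
  simp only [inner_D_conj, mul_left_comm]

theorem ae_eq_zero_of_integral_mul_inner_D (hd : Dense (V : Set H))
    (hV : ∀ z, ∀ φ ∈ V, D z φ ∈ V) {g : ℂ → ℂ}
    (hg : ∀ φ ∈ V, ∀ ψ ∈ V, Integrable (fun w => g w * ⟪φ, D w ψ⟫_ℂ) phaseMeasure)
    (h0 : ∀ φ ∈ V, ∀ ψ ∈ V, ∫ w, g w * ⟪φ, D w ψ⟫_ℂ ∂phaseMeasure = 0) :
    g =ᵐ[phaseMeasure] 0 := by
  have hzero (φ) (hφ : φ ∈ V) (ψ) (hψ : ψ ∈ V) :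
      (fun w => g w * ⟪φ, D w ψ⟫_ℂ) =ᵐ[phaseMeasure] 0 :=
    ae_eq_zero_of_symplecticFourier_eq_zero (hg φ hφ ψ hψ) fun z => by
      rw [← integral_mul_inner_D_conj, h0 _ (hV z φ hφ) _ (hV z ψ hψ)]
  obtain ⟨ψ, hψ, s, hsV, hs, hs0⟩ := exists_countable_forall_inner_D_ne_zero hd
  filter_upwards [(ae_ball_iff hs).2 fun φ hφ => hzero φ (hsV hφ) ψ hψ] with w hw
  obtain ⟨φ, hφ, hφ0⟩ := hs0 w
  exact (mul_eq_zero.1 (hw φ hφ)).resolve_right hφ0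

theorem memLp_inner_D (φ ψ : H) : MemLp (fun z => ⟪D z ψ, φ⟫_ℂ) 2 phaseMeasure :=
  ⟨(measurable_inner_D_left φ ψ).aestronglyMeasurable,
    eLpNorm_inner_D φ ψ ▸ ENNReal.ofReal_lt_top⟩

theorem isMoyalFrame_D : IsMoyalFrame D phaseMeasure where
  aestronglyMeasurable φ ψ := (measurable_inner_D_left φ ψ).aestronglyMeasurable
  eLpNorm_eq := eLpNorm_inner_D
  ae_eq_zero _ hf h := ae_eq_zero_of_integral_mul_inner_D (V := ⊤) dense_univ (fun _ _ h => h)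
    (fun φ _ ψ _ => integrable_mul_inner_of_memLp hf (memLp_inner_D φ ψ)) fun φ _ ψ _ => h φ ψ

theorem aestronglyMeasurable_of_mul_inner_D (hd : Dense (V : Set H)) {g : ℂ → ℂ}
    (hg : ∀ φ ∈ V, ∀ ψ ∈ V, Integrable (fun w => g w * ⟪φ, D w ψ⟫_ℂ) phaseMeasure) :
    AEStronglyMeasurable g phaseMeasure := by
  obtain ⟨ψ, hψ, s, hsV, hs, hs0⟩ := exists_countable_forall_inner_D_ne_zero hd
  have := hs.to_subtype
  refine aestronglyMeasurable_of_mul (c := fun (φ : s) w => ⟪(φ : H), D w ψ⟫_ℂ) (fun φ => ?_)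
    (fun φ => (hg φ (hsV φ.2) ψ hψ).aestronglyMeasurable) fun w => ?_
  · simpa only [Function.comp_def, inner_conj_symm] using
      RCLike.continuous_conj.measurable.comp (measurable_inner_D_left (φ : H) ψ)
  · obtain ⟨φ, hφ, hφ0⟩ := hs0 w
    exact ⟨⟨φ, hφ⟩, hφ0⟩

end Totality

section Displaced

theorem symplecticFourier_conj (h : ℂ → ℂ) (z : ℂ) :
    symplecticFourier (fun w => starRingEnd ℂ (h w)) z =
      starRingEnd ℂ (symplecticFourier h (-z)) := by
  rw [symplecticFourier_apply, symplecticFourier_apply, ← integral_conj]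
  simp only [map_mul, map_neg, LinearMap.neg_apply, AddChar.map_neg_eq_inv,
    ← Circle.coe_inv_eq_conj, inv_inv]

variable {ϖ : ℂ → ℂ} {M : H →L[ℂ] H} {V : Submodule ℂ H}

theorem inner_displaced (M : H →L[ℂ] H) (z : ℂ) (φ ψ : H) :
    ⟪φ, displaced M z ψ⟫_ℂ = ⟪D (-z) φ, M (D (-z) ψ)⟫_ℂ := by
  simp only [displaced, ContinuousLinearMap.comp_apply, ← adjoint_D,
    ContinuousLinearMap.adjoint_inner_left]

theorem inner_displaced_eq_symplecticFourier (hV : ∀ z, ∀ φ ∈ V, D z φ ∈ V)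
    (hM : ∀ φ ∈ V, ∀ ψ ∈ V, ⟪φ, M ψ⟫_ℂ = ∫ w, ϖ w * ⟪φ, D w ψ⟫_ℂ ∂phaseMeasure)
    {φ ψ : H} (hφ : φ ∈ V) (hψ : ψ ∈ V) (z : ℂ) :
    ⟪φ, displaced M z ψ⟫_ℂ = symplecticFourier (fun w => ϖ w * ⟪φ, D w ψ⟫_ℂ) (-z) := by
  rw [inner_displaced, hM _ (hV _ _ hφ) _ (hV _ _ hψ), integral_mul_inner_D_conj]

theorem inner_displaced_left_eq_symplecticFourier (hV : ∀ z, ∀ φ ∈ V, D z φ ∈ V)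
    (hM : ∀ φ ∈ V, ∀ ψ ∈ V, ⟪φ, M ψ⟫_ℂ = ∫ w, ϖ w * ⟪φ, D w ψ⟫_ℂ ∂phaseMeasure)
    {φ ψ : H} (hφ : φ ∈ V) (hψ : ψ ∈ V) (z : ℂ) :
    ⟪displaced M z ψ, φ⟫_ℂ =
      symplecticFourier (fun w => starRingEnd ℂ (ϖ w) * ⟪D w ψ, φ⟫_ℂ) z := by
  rw [← inner_conj_symm, inner_displaced_eq_symplecticFourier hV hM hφ hψ,
    ← symplecticFourier_conj]
  simp only [map_mul, inner_conj_symm]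

theorem aestronglyMeasurable_weight (hM : IsWeightIntegral ϖ M) :
    AEStronglyMeasurable ϖ phaseMeasure := by
  obtain ⟨V, hd, -, hϖ⟩ := hM
  exact aestronglyMeasurable_of_mul_inner_D hd fun φ hφ ψ hψ => (hϖ φ hφ ψ hψ).1

theorem isMoyalFrame_displaced (hM : IsWeightIntegral ϖ M)
    (hϖ : ∀ᵐ z ∂phaseMeasure, ‖ϖ z‖ = 1) : IsMoyalFrame (displaced M) phaseMeasure := by
  have hu := IsUnitaryWeight.of_norm_eq_one (w := fun z => starRingEnd ℂ (ϖ z))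
    (aestronglyMeasurable_weight hM).star (by simpa only [RCLike.norm_conj] using hϖ)
  obtain ⟨V, hd, hV, hint⟩ := hM
  refine isMoyalFrame_D.of_unitary (hu.unitary.trans symplecticFourierₗᵢ) hd fun φ hφ ψ hψ => ?_
  have hmul : hu.unitary (isMoyalFrame_D.coeff ψ φ) =ᵐ[phaseMeasure]
      fun w => starRingEnd ℂ (ϖ w) * ⟪D w ψ, φ⟫_ℂ := by
    filter_upwards [hu.coeFn_unitary (isMoyalFrame_D.coeff ψ φ),
      isMoyalFrame_D.coeFn_coeff ψ φ] with w h₁ h₂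
    rw [h₁, MeasurableEquiv.refl_apply, h₂]
  have h₁ : Integrable (fun w => starRingEnd ℂ (ϖ w) * ⟪D w ψ, φ⟫_ℂ) phaseMeasure := by
    simpa only [ContinuousLinearEquiv.coe_coe, Complex.conjCLE_apply, map_mul,
      inner_conj_symm] using
      Complex.conjCLE.toContinuousLinearMap.integrable_comp (hint φ hφ ψ hψ).1
  have h₂ : MemLp (fun w => starRingEnd ℂ (ϖ w) * ⟪D w ψ, φ⟫_ℂ) 2 phaseMeasure :=
    (memLp_congr_ae hmul).1 (Lp.memLp _)
  have hLp : hu.unitary (isMoyalFrame_D.coeff ψ φ) = h₂.toLp _ :=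
    Lp.ext (hmul.trans h₂.coeFn_toLp.symm)
  rw [LinearIsometryEquiv.trans_apply, hLp]
  refine (coeFn_symplecticFourierₗᵢ h₁ h₂).trans (.of_forall fun z => ?_)
  exact (inner_displaced_left_eq_symplecticFourier hV (fun φ hφ ψ hψ => (hint φ hφ ψ hψ).2)
    hφ hψ z).symm

theorem adjoint_displaced (M : H →L[ℂ] H) (z : ℂ) :
    ContinuousLinearMap.adjoint (displaced M z) = displaced (ContinuousLinearMap.adjoint M) z := by
  simp only [displaced, ContinuousLinearMap.adjoint_comp, ContinuousLinearMap.adjoint_adjoint,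
    ContinuousLinearMap.comp_assoc]

theorem inner_displaced_adjoint_comp_apply (M A : H →L[ℂ] H) (z : ℂ) (φ : H) :
    ⟪φ, (displaced (ContinuousLinearMap.adjoint M) z ∘L A) φ⟫_ℂ =
      ⟪displaced M z φ, A φ⟫_ℂ := by
  rw [ContinuousLinearMap.comp_apply, ← adjoint_displaced,
    ContinuousLinearMap.adjoint_inner_right]

theorem adjoint_eq_self_of_isRegularWeight (hM : IsWeightIntegral ϖ M)
    (hϖ : IsRegularWeight ϖ) : ContinuousLinearMap.adjoint M = M := by
  obtain ⟨V, hd, -, hint⟩ := hM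
  refine ContinuousLinearMap.ext_on (s := V) (hd.mono Submodule.subset_span) fun ψ hψ => ?_
  refine hd.eq_of_inner_right ℂ fun φ hφ => ?_
  rw [ContinuousLinearMap.adjoint_inner_right, ← inner_conj_symm, (hint ψ hψ φ hφ).2,
    (hint φ hφ ψ hψ).2, ← integral_conj, integral_phaseMeasure, integral_phaseMeasure,
    ← integral_neg_eq_self]
  congr 2 with z
  rw [map_mul, hϖ.2, hϖ.1, inner_conj_symm, ← adjoint_D, ContinuousLinearMap.adjoint_inner_left]

end Displaced

section HilbertSchmidt

theorem inner_adjoint_comp_self_apply (A : H →L[ℂ] H) (φ : H) :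
    ⟪φ, (ContinuousLinearMap.adjoint A ∘L A) φ⟫_ℂ = ((‖A φ‖ ^ 2 : ℝ) : ℂ) := by
  rw [ContinuousLinearMap.comp_apply, ContinuousLinearMap.adjoint_inner_right,
    inner_self_eq_norm_sq_to_K]
  norm_cast

theorem isHilbertSchmidt_iff_summable (b : HilbertBasis ℕ ℂ H) {A : H →L[ℂ] H} :
    IsHilbertSchmidt A ↔ Summable fun n => ‖A (b n)‖ ^ 2 := by
  simp only [IsHilbertSchmidt, HasTrace, inner_adjoint_comp_self_apply]
  exact ⟨fun ⟨_, ht⟩ => Complex.summable_ofReal.1 (ht b).summable, fun h => ⟨_, fun b' =>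
    Complex.hasSum_ofReal.2 (hasSum_norm_apply_sq_of_hilbertBasis b b' h.hasSum)⟩⟩

theorem nonempty_hilbertBasis_H : Nonempty (HilbertBasis ℕ ℂ H) :=
  nonempty_hilbertBasis_nat not_finiteDimensional_H

theorem IsHilbertSchmidt.comp_left {A : H →L[ℂ] H} (hA : IsHilbertSchmidt A) (X : H →L[ℂ] H) :
    IsHilbertSchmidt (X ∘L A) := by
  obtain ⟨b⟩ := nonempty_hilbertBasis_H
  rw [isHilbertSchmidt_iff_summable b] at hA ⊢
  refine .of_nonneg_of_le (fun _ => sq_nonneg _) (fun n => ?_) (hA.mul_left (‖X‖ ^ 2))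
  rw [← mul_pow]
  exact pow_le_pow_left₀ (norm_nonneg _) (X.le_opNorm _) 2

theorem IsHilbertSchmidt.adjoint {A : H →L[ℂ] H} (hA : IsHilbertSchmidt A) :
    IsHilbertSchmidt (ContinuousLinearMap.adjoint A) := by
  obtain ⟨b⟩ := nonempty_hilbertBasis_H
  rw [isHilbertSchmidt_iff_summable b] at hA ⊢
  exact (hasSum_norm_adjoint_apply_sq b b hA.hasSum).summable

namespace IsMoyalFrame

variable {X : Type*} [MeasurableSpace X] {μ : Measure X} {N : X → H →L[ℂ] H}

theorem hasTrace_adjoint_op_comp_op (hN : IsMoyalFrame N μ) (f g : Lp ℂ 2 μ) :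
    HasTrace (ContinuousLinearMap.adjoint (hN.op f) ∘L hN.op g) ⟪f, g⟫_ℂ := fun b => by
  simpa only [ContinuousLinearMap.comp_apply, ContinuousLinearMap.adjoint_inner_right] using
    hN.hasSum_inner_op b f g

theorem isHilbertSchmidt_iff (hN : IsMoyalFrame N μ) {A : H →L[ℂ] H} :
    IsHilbertSchmidt A ↔ ∃ f, hN.op f = A := by
  obtain ⟨b⟩ := nonempty_hilbertBasis_H
  refine ⟨fun hA => hN.exists_op_eq b ((isHilbertSchmidt_iff_summable b).1 hA), ?_⟩
  rintro ⟨f, rfl⟩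
  exact ⟨_, hN.hasTrace_adjoint_op_comp_op f f⟩

end IsMoyalFrame

theorem IsTraceClass.exists_hasTrace_comp {A : H →L[ℂ] H} (hA : IsTraceClass A)
    (X : H →L[ℂ] H) : ∃ t, HasTrace (X ∘L A) t := by
  obtain ⟨B, C, hB, hC, rfl⟩ := hA
  obtain ⟨f, hf⟩ := isMoyalFrame_D.isHilbertSchmidt_iff.1 (hB.comp_left X).adjoint
  obtain ⟨g, rfl⟩ := isMoyalFrame_D.isHilbertSchmidt_iff.1 hC
  refine ⟨⟪f, g⟫_ℂ, ?_⟩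
  simpa only [hf, ContinuousLinearMap.adjoint_adjoint, ContinuousLinearMap.comp_assoc] using
    isMoyalFrame_D.hasTrace_adjoint_op_comp_op f g

end HilbertSchmidt

section Quantization

theorem inner_toLp_self {α : Type*} [MeasurableSpace α] {μ : Measure α} {f : α → ℂ}
    (hf : MemLp f 2 μ) :
    ⟪hf.toLp f, hf.toLp f⟫_ℂ = ((∫ x, ‖f x‖ ^ 2 ∂μ : ℝ) : ℂ) := by
  rw [L2.inner_def, ← integral_complex_ofReal]
  refine integral_congr_ae ?_
  filter_upwards [hf.coeFn_toLp] with x hx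
  rw [hx, inner_self_eq_norm_sq_to_K]
  norm_cast

namespace IsMoyalFrame

variable {M : H →L[ℂ] H}

theorem isQuantization_iff (hM : IsMoyalFrame (displaced M) phaseMeasure) {f : ℂ → ℂ}
    (hf : MemLp f 2 phaseMeasure) {A : H →L[ℂ] H} :
    IsQuantization M f A ↔ hM.op (hf.toLp f) = A :=
  (hM.op_eq_iff hf A).symm

theorem isometricOn (hM : IsMoyalFrame (displaced M) phaseMeasure) :
    IsometricOn M squareIntegrable := fun f hf =>
  ⟨hM.op (hf.toLp f), (hM.isQuantization_iff hf).2 rfl,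
    inner_toLp_self hf ▸ hM.hasTrace_adjoint_op_comp_op (hf.toLp f) (hf.toLp f)⟩

theorem ae_eq_of_isQuantization (hM : IsMoyalFrame (displaced M) phaseMeasure) {f g : ℂ → ℂ}
    (hf : MemLp f 2 phaseMeasure) (hg : MemLp g 2 phaseMeasure) {A : H →L[ℂ] H}
    (hfA : IsQuantization M f A) (hgA : IsQuantization M g A) : f =ᵐ[phaseMeasure] g := by
  rw [hM.isQuantization_iff hf] at hfA
  rw [hM.isQuantization_iff hg] at hgA
  exact (MemLp.toLp_eq_toLp_iff hf hg).1 (hM.op_injective (hfA.trans hgA.symm))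

theorem isInvertible (hM : IsMoyalFrame (displaced M) phaseMeasure) : IsInvertible M := by
  refine ⟨fun f hf => ⟨_, (hM.isQuantization_iff hf).2 rfl, hM.isHilbertSchmidt_iff.2 ⟨_, rfl⟩⟩,
    fun A hA => ?_, fun f hf g hg A => hM.ae_eq_of_isQuantization hf hg⟩
  obtain ⟨f, rfl⟩ := hM.isHilbertSchmidt_iff.1 hA
  exact ⟨f, Lp.memLp f, (hM.isQuantization_iff (Lp.memLp f)).2 (by rw [Lp.toLp_coeFn])⟩

theorem exists_ae_eq_hasTrace (hM : IsMoyalFrame (displaced M) phaseMeasure)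
    (f : Lp ℂ 2 phaseMeasure) : ∃ W : ℂ → ℂ, W =ᵐ[phaseMeasure] f ∧
      (IsTraceClass (hM.op f) →
        ∀ z, HasTrace (displaced (ContinuousLinearMap.adjoint M) z ∘L hM.op f) (W z)) := by
  by_cases hT : IsTraceClass (hM.op f)
  · choose W hW using fun z =>
      hT.exists_hasTrace_comp (displaced (ContinuousLinearMap.adjoint M) z)
    obtain ⟨b⟩ := nonempty_hilbertBasis_H
    refine ⟨W, hM.ae_eq_of_hasSum_inner_op b fun z => ?_, fun _ => hW⟩
    simpa only [inner_displaced_adjoint_comp_apply] using hW z b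
  · exact ⟨f, .rfl, fun h => absurd h hT⟩

theorem inverseIsTrace (hM : IsMoyalFrame (displaced M) phaseMeasure) :
    InverseIsTrace M (ContinuousLinearMap.adjoint M) := by
  intro A hA
  obtain ⟨f, rfl⟩ := hM.isHilbertSchmidt_iff.1 hA
  obtain ⟨W, hWf, htrace⟩ := hM.exists_ae_eq_hasTrace f
  have hW : MemLp W 2 phaseMeasure := (memLp_congr_ae hWf).2 (Lp.memLp f)
  have hquant : IsQuantization M W (hM.op f) :=
    (hM.isQuantization_iff hW).2 (congrArg _ (Lp.ext (hW.coeFn_toLp.trans hWf)))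
  refine ⟨W, hW, hquant, fun g hg hgA => hM.ae_eq_of_isQuantization hg hW hgA hquant,
    fun b => (hM.tendsto_eLpNorm_sum_inner_op b f).congr fun s => eLpNorm_congr_ae ?_, htrace⟩
  simp only [inner_displaced_adjoint_comp_apply]
  exact EventuallyEq.rfl.sub hWf.symm

end IsMoyalFrame

end Quantization

section Necessity

variable {ϖ f : ℂ → ℂ} {M : H →L[ℂ] H}

theorem integrable_symplecticFourier_mul {h : ℂ → ℂ} (hf : Integrable f phaseMeasure)
    (hh : Integrable h phaseMeasure) :
    Integrable (fun w => symplecticFourier f w * h w) phaseMeasure :=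
  hh.bdd_mul (continuous_symplecticFourier hf).aestronglyMeasurable
    (.of_forall fun w => VectorFourier.norm_fourierIntegral_le_integral_norm _ _ _ f w)

theorem integral_mul_inner_displaced {V : Submodule ℂ H} (hV : ∀ z, ∀ φ ∈ V, D z φ ∈ V)
    (hM : ∀ φ ∈ V, ∀ ψ ∈ V, Integrable (fun z => ϖ z * ⟪φ, D z ψ⟫_ℂ) phaseMeasure ∧
      ⟪φ, M ψ⟫_ℂ = ∫ z, ϖ z * ⟪φ, D z ψ⟫_ℂ ∂phaseMeasure)
    (hf : Integrable f phaseMeasure) {φ ψ : H} (hφ : φ ∈ V) (hψ : ψ ∈ V) :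
    ∫ z, f z * ⟪φ, displaced M z ψ⟫_ℂ ∂phaseMeasure =
      ∫ w, symplecticFourier f w * (ϖ w * ⟪φ, D w ψ⟫_ℂ) ∂phaseMeasure := by
  rw [← integral_mul_symplecticFourier_neg hf (hM φ hφ ψ hψ).1]
  simp only [inner_displaced_eq_symplecticFourier hV (fun φ hφ ψ hψ => (hM φ hφ ψ hψ).2) hφ hψ]

theorem ae_eq_mul_symplecticFourier_of_isQuantization (hM : IsWeightIntegral ϖ M)
    (hf : Integrable f phaseMeasure) {G : Lp ℂ 2 phaseMeasure}
    (hG : IsQuantization M f (isMoyalFrame_D.op G)) :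
    G =ᵐ[phaseMeasure] fun w => ϖ w * symplecticFourier f w := by
  obtain ⟨V, hd, hV, hint⟩ := hM
  have hsplit (φ ψ : H) (w : ℂ) : (G w - ϖ w * symplecticFourier f w) * ⟪φ, D w ψ⟫_ℂ =
      G w * ⟪φ, D w ψ⟫_ℂ - symplecticFourier f w * (ϖ w * ⟪φ, D w ψ⟫_ℂ) := by ring
  have hG_int (φ ψ : H) := isMoyalFrame_D.integrable_mul_inner (Lp.memLp G) φ ψ
  have hf_int (φ) (hφ : φ ∈ V) (ψ) (hψ : ψ ∈ V) :=
    integrable_symplecticFourier_mul hf (hint φ hφ ψ hψ).1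
  have hzero : (fun w => G w - ϖ w * symplecticFourier f w) =ᵐ[phaseMeasure] 0 := by
    refine ae_eq_zero_of_integral_mul_inner_D hd hV (fun φ hφ ψ hψ => ?_) fun φ hφ ψ hψ => ?_
    · simp only [hsplit]
      exact (hG_int φ ψ).sub (hf_int φ hφ ψ hψ)
    · simp only [hsplit]
      rw [integral_sub (hG_int φ ψ) (hf_int φ hφ ψ hψ), sub_eq_zero,
        ← isMoyalFrame_D.inner_coeff_toLp ψ φ (Lp.memLp G), Lp.toLp_coeFn,
        ← isMoyalFrame_D.inner_op, (hG φ ψ).2, integral_mul_inner_displaced hV hint hf hφ hψ]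
  exact hzero.mono fun w hw => sub_eq_zero.1 hw

theorem eLpNorm_mul_symplecticFourier (hM : IsWeightIntegral ϖ M)
    (h : IsometricOn M integrableSquareIntegrable) (hf₁ : Integrable f phaseMeasure)
    (hf₂ : MemLp f 2 phaseMeasure) :
    eLpNorm (fun w => ϖ w * symplecticFourier f w) 2 phaseMeasure =
      eLpNorm f 2 phaseMeasure := by
  obtain ⟨A, hA, htr⟩ := h f ⟨memLp_one_iff_integrable.2 hf₁, hf₂⟩
  obtain ⟨G, rfl⟩ := isMoyalFrame_D.isHilbertSchmidt_iff.1 ⟨_, htr⟩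
  obtain ⟨b⟩ := nonempty_hilbertBasis_H
  have hinner := (isMoyalFrame_D.hasTrace_adjoint_op_comp_op G G b).unique (htr b)
  have hnorm : ‖G‖ = ‖hf₂.toLp f‖ := by
    rw [norm_eq_sqrt_re_inner (𝕜 := ℂ) G, norm_eq_sqrt_re_inner (𝕜 := ℂ) (hf₂.toLp f),
      inner_toLp_self, hinner]
  rw [← eLpNorm_congr_ae (ae_eq_mul_symplecticFourier_of_isQuantization hM hf₁ hA),
    ← eLpNorm_congr_ae hf₂.coeFn_toLp, ← Lp.enorm_def, ← Lp.enorm_def, ← ofReal_norm, hnorm,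
    ofReal_norm]

theorem norm_weight_eq_one (hM : IsWeightIntegral ϖ M)
    (h : IsometricOn M integrableSquareIntegrable) : ∀ᵐ z ∂phaseMeasure, ‖ϖ z‖ = 1 := by
  have hϖ := aestronglyMeasurable_weight hM
  have hdense := symplecticFourierₗᵢ.surjective.denseRange.dense_image
    symplecticFourierₗᵢ.continuous
    (dense_setOf_integrable (F := ℂ) (μ := phaseMeasure) (p := 2) ENNReal.ofNat_ne_top)
  refine norm_eq_one_ae_of_eLpNorm_mul_eq hϖ (eLpNorm_mul_eq_of_dense hϖ hdense ?_)
  rintro _ ⟨f, hf, rfl⟩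
  have hcoe : symplecticFourierₗᵢ f =ᵐ[phaseMeasure] symplecticFourier f := by
    simpa only [Lp.toLp_coeFn] using coeFn_symplecticFourierₗᵢ hf (Lp.memLp f)
  calc eLpNorm (fun w => ϖ w * symplecticFourierₗᵢ f w) 2 phaseMeasure
      = eLpNorm (fun w => ϖ w * symplecticFourier f w) 2 phaseMeasure :=
        eLpNorm_congr_ae (hcoe.mono fun w hw => congrArg (ϖ w * ·) hw)
    _ = eLpNorm f 2 phaseMeasure := eLpNorm_mul_symplecticFourier hM h hf (Lp.memLp f)
    _ = eLpNorm (symplecticFourierₗᵢ f) 2 phaseMeasure := by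
      rw [← Lp.enorm_def, ← Lp.enorm_def, ← ofReal_norm, ← ofReal_norm,
        LinearIsometryEquiv.norm_map]

end Necessity

end WeylHeisenberg

end

theorem mainTheorem8 (ϖ : ℂ → ℂ) (hϖ0 : ϖ 0 = 1)
    (M : WeylHeisenberg.H →L[ℂ] WeylHeisenberg.H) (hM : IsWeightIntegral ϖ M) :
    (IsometricOn M squareIntegrable ↔ ∀ᵐ z ∂(MeasureTheory.volume : MeasureTheory.Measure ℂ), ‖ϖ z‖ = 1) ∧
    (IsometricOn M integrableSquareIntegrable ↔
      ∀ᵐ z ∂(MeasureTheory.volume : MeasureTheory.Measure ℂ), ‖ϖ z‖ = 1) ∧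
    (Continuous ϖ → (IsometricOn M squareIntegrable ↔ ∀ z, ‖ϖ z‖ = 1)) ∧
    ((∀ᵐ z ∂(MeasureTheory.volume : MeasureTheory.Measure ℂ), ‖ϖ z‖ = 1) →
      IsInvertible M ∧
      InverseIsTrace M (ContinuousLinearMap.adjoint M) ∧
      (IsRegularWeight ϖ → ContinuousLinearMap.adjoint M = M ∧ InverseIsTrace M M)) := by
  have hmono : IsometricOn M squareIntegrable → IsometricOn M integrableSquareIntegrable :=
    fun h f hf => h f hf.2
  have hframe (h : ∀ᵐ z, ‖ϖ z‖ = 1) : IsMoyalFrame (displaced M) phaseMeasure :=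
    isMoyalFrame_displaced hM (ae_phaseMeasure_eq ▸ h)
  have hnorm (h : IsometricOn M integrableSquareIntegrable) : ∀ᵐ z, ‖ϖ z‖ = 1 :=
    ae_phaseMeasure_eq ▸ norm_weight_eq_one hM h
  have hiff : IsometricOn M squareIntegrable ↔ ∀ᵐ z, ‖ϖ z‖ = 1 :=
    ⟨fun h => hnorm (hmono h), fun h => (hframe h).isometricOn⟩
  refine ⟨hiff, ⟨hnorm, fun h => hmono (hiff.2 h)⟩, fun hc => hiff.trans ?_, fun h =>
    ⟨(hframe h).isInvertible, (hframe h).inverseIsTrace, fun hr => ?_⟩⟩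
  · exact (hc.norm.ae_eq_iff_eq volume continuous_const).trans funext_iff
  · have hself := adjoint_eq_self_of_isRegularWeight hM hr
    have htrace := (hframe h).inverseIsTrace
    rw [hself] at htrace
    exact ⟨hself, htrace⟩
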